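/- Lemma 3.1. In the communication problem $\mathsf{UR}_{\mathrm{dec}}^{\subset}$ over $[U]=\{1,\dots,U\}$, Alice receives a set $S\subseteq[U]$, and Bob receives a proper subset $T\subsetneq S$ together with a partition $(P_1,P_2)$ of $[U]\setminus T$ (a part may be empty); it is promised that $S\setminus T\subseteq P_1$ or $S\setminus T\subseteq P_2$. In a one-way protocol Alice sends one message, a bit string, to Bob, who must then decide which of $P_1,P_2$ contains $S\setminus T$; the players may use shared (and private) randomness independent of the input. The communication cost is the length of the message. There are an absolute constant $c>0$ and an integer $U_0$ such that for every integer $U\ge U_0$ and every real $\delta$ with $\exp(-U^{1/4})<\delta<1/\log^4 U$ there is a probability distribution $\mathcal D$ on the inputs $(S,T,P_1,P_2)$ of $\mathsf{UR}_{\mathrm{dec}}^{\subset}$ over $[U]$ with the following property: every randomized one-way protocol that succeeds with probability at least $1-\delta$ on a random input from $\mathcal D$ has expected communication cost at least $c\,\log(1/\delta)\,\log^2 U$. Probability and expectation are over both the random input and the randomness of the protocol, and $\log$ is the natural logarithm. -/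

import Mathlib

open MeasureTheory
open scoped ENNReal

/-- An input of the decision version of universal relation over `[U]`, the universe `[U]` being
`Fin U`. Alice holds `S`; Bob holds a proper subset `T` of `S` and a partition `(P₁, P₂)` of
`[U] \ T` (a part may be empty), with the promise that one of the two parts contains `S \ T`. -/
structure URDecInput (U : ℕ) where
  S : Finset (Fin U)
  T : Finset (Fin U)
  P₁ : Finset (Fin U)
  P₂ : Finset (Fin U)
  T_ssubset_S : T ⊂ S
  parts_disjoint : Disjoint P₁ P₂
  parts_union : P₁ ∪ P₂ = Tᶜ
  promise : S \ T ⊆ P₁ ∨ S \ T ⊆ P₂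

/-- The answer `true` stands for "`P₁` contains `S \ T`" and `false` for "`P₂` contains `S \ T`".
As `S \ T` is nonempty and `P₁`, `P₂` are disjoint, every input has exactly one correct answer. -/
def URDecInput.IsCorrect {U : ℕ} (x : URDecInput U) (answer : Bool) : Prop :=
  x.S \ x.T ⊆ if answer then x.P₁ else x.P₂

/-- A randomized one-way protocol. The random string `ω`, drawn independently of the input, is seen
by both players (this public-coin model includes private coins: a player may ignore a part of `ω`).
Alice's message, a bit string of any length, is a function of `ω` and her set; Bob's answer
is a function of `ω`, the message and his input `(T, P₁, P₂)`. -/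
structure OneWayProtocol (U : ℕ) where
  Ω : Type*
  [measurableSpace : MeasurableSpace Ω]
  coins : Measure Ω
  [isProbabilityMeasure : IsProbabilityMeasure coins]
  alice : Ω → Finset (Fin U) → List Bool
  bob : Ω → List Bool → Finset (Fin U) → Finset (Fin U) → Finset (Fin U) → Bool
  measurableSet_alice : ∀ S msg, MeasurableSet {ω | alice ω S = msg}
  measurableSet_bob : ∀ msg T P₁ P₂ b, MeasurableSet {ω | bob ω msg T P₁ P₂ = b}

attribute [instance] OneWayProtocol.measurableSpace OneWayProtocol.isProbabilityMeasure

namespace OneWayProtocol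

/-- The answer given by Bob on the input `x` when the random string is `ω`. -/
def output {U : ℕ} (P : OneWayProtocol U) (ω : P.Ω) (x : URDecInput U) : Bool :=
  P.bob ω (P.alice ω x.S) x.T x.P₁ x.P₂

/-- The probability, over a random input from `D` and the coins, that Bob's answer is correct. -/
noncomputable def successProb {U : ℕ} (P : OneWayProtocol U) (D : PMF (URDecInput U)) : ℝ≥0∞ :=
  ∑' x, D x * P.coins {ω | x.IsCorrect (P.output ω x)}

/-- The expected number of bits sent by Alice, over a random input from `D` and the coins
(possibly infinite). -/
noncomputable def expectedCost {U : ℕ} (P : OneWayProtocol U) (D : PMF (URDecInput U)) : ℝ≥0∞ :=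
  ∑' x, D x * ∫⁻ ω, ((P.alice ω x.S).length : ℝ≥0∞) ∂P.coins

end OneWayProtocol

/-! The hard input. Alice holds the graph of a uniform word `x : ι → β` with `m = |ι|` of order `U ^
(1/3)` and `|β| = (32 m) ^ 2`. A scale `t < N` is uniform, `J` keeps each coordinate with
probability `ρ ^ t`, `ρ = 1 - 1 / K`, and Bob sees `x` off `J`. The points of `ι × β` are coloured
at random, except that the graph over `J` gets a single random colour `σ`, which Bob must name. Here
`K` is about `log (1/δ) / 2` and `N` is of order `K log U`.

Fixing good coins and a frequent message leaves a set `G` of words with entropy deficiency `O(C +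
1)`, `C` being the cost, on which Bob's rule has average error `O(δ)`. The core estimate
(`futureErrorBound`) says that the errors, summed over the scales and over `G`, are at least `exp
(-K) |G| (N / 8 - α * deficiency)` with `α = 9 / log (32 m)`. Since `exp (-K) ≥ √δ` is far above
`δ`, the deficiency must be of order `N log U`, that is, `log (1/δ) log² U`.

The estimate is a backward induction over the scales with `r = 1 / (32 m)`. If a spread set fills
half of `G`, a second moment computation shows that Bob's view hardly depends on `σ`, so he errs at
the current scale (`le_sum_guessError`). Otherwise at least half of `G` splits into pieces, each
constant on some `W` and of relative size about `r ^ |W|` or more. Fixing `W` lowers the deficiency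
by about `|W| log (r |β|) = |W| log (32 m)`, worth `9 |W|` after scaling by `α`. The price is that
later sets must avoid `W`, which has probability `(1 - ρ ^ τ) ^ |W|` after `τ` steps. The logarithms
of these factors sum to at most `4 K |W|` (`sum_neg_log_one_sub_pow_le`), a loss of only `4 |W|` in
units of `K`. The exponents `Λ` record these factors; a scale is worth counting only while its `Λ`
is below `K`, which is where `exp (-K)` comes from. -/

/-! ### Random subsets with independent coordinates -/

section Thinning

variable {ι : Type*}

/-- The expectation of `f` at the random subset of `J` that contains each element of `J`
independently with probability `q`. -/
noncomputable def thin (q : ℝ) (J : Finset ι) (f : Finset ι → ℝ) : ℝ :=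
  ∑ Y ∈ J.powerset, q ^ Y.card * (1 - q) ^ (J.card - Y.card) * f Y

lemma thin_const (q : ℝ) (J : Finset ι) (a : ℝ) : thin q J (fun _ => a) = a := by
  unfold thin
  rw [← Finset.sum_mul, Finset.sum_pow_mul_eq_add_pow]
  simp

lemma thin_one (J : Finset ι) (f : Finset ι → ℝ) : thin 1 J f = f J := by
  unfold thin
  rw [Finset.sum_eq_single J]
  · simp
  · intro Y hY hne
    have hYJ := Finset.mem_powerset.1 hY
    have : Y.card < J.card := Finset.card_lt_card (lt_of_le_of_ne hYJ hne)
    have h0 : J.card - Y.card ≠ 0 := by omega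
    simp [h0]
  · simp

lemma thin_mono {q : ℝ} (h0 : 0 ≤ q) (h1 : q ≤ 1) {J : Finset ι} {f g : Finset ι → ℝ}
    (h : ∀ Y ⊆ J, f Y ≤ g Y) : thin q J f ≤ thin q J g := by
  refine Finset.sum_le_sum fun Y hY => ?_
  have : 0 ≤ 1 - q := by linarith
  exact mul_le_mul_of_nonneg_left (h Y (Finset.mem_powerset.1 hY)) (by positivity)

lemma thin_nonneg {q : ℝ} (h0 : 0 ≤ q) (h1 : q ≤ 1) {J : Finset ι} {f : Finset ι → ℝ}
    (h : ∀ Y, 0 ≤ f Y) : 0 ≤ thin q J f := by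
  have := thin_mono h0 h1 (J := J) (f := fun _ => 0) (g := f) (fun Y _ => h Y)
  rwa [thin_const] at this

lemma thin_sum {α : Type*} (s : Finset α) (q : ℝ) (J : Finset ι) (f : α → Finset ι → ℝ) :
    ∑ a ∈ s, thin q J (f a) = thin q J (fun Y => ∑ a ∈ s, f a Y) := by
  unfold thin
  rw [Finset.sum_comm]
  simp [Finset.mul_sum]

lemma thin_mul_left (q c : ℝ) (J : Finset ι) (f : Finset ι → ℝ) :
    thin q J (fun Y => c * f Y) = c * thin q J f := by
  unfold thin
  rw [Finset.mul_sum]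
  exact Finset.sum_congr rfl fun Y _ => by ring

lemma thin_thin [DecidableEq ι] (p q : ℝ) (J : Finset ι) (f : Finset ι → ℝ) :
    thin p J (fun Y => thin q Y f) = thin (p * q) J f := by
  unfold thin
  simp_rw [Finset.mul_sum]
  rw [Finset.sum_comm' (s' := fun Z => J.powerset.filter (Z ⊆ ·)) (t' := J.powerset)
    (by intro Y Z; simp only [Finset.mem_powerset, Finset.mem_filter]
        exact ⟨fun h => ⟨h, h.2.trans h.1⟩, fun h => h.1⟩)]
  refine Finset.sum_congr rfl fun Z hZ => ?_
  have hZJ := Finset.mem_powerset.1 hZ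
  have key : ∑ V ∈ (J \ Z).powerset,
      (p * (1 - q)) ^ V.card * (1 - p) ^ ((J \ Z).card - V.card) = (1 - p * q) ^ (J \ Z).card := by
    rw [Finset.sum_pow_mul_eq_add_pow]; congr 1; ring
  rw [← Finset.card_sdiff_of_subset hZJ, ← key, Finset.mul_sum, Finset.sum_mul]
  refine Finset.sum_bij' (fun Y _ => Y \ Z) (fun V _ => V ∪ Z) ?_ ?_ ?_ ?_ ?_
  · intro Y hY
    simp only [Finset.mem_filter, Finset.mem_powerset] at hY ⊢
    exact Finset.sdiff_subset_sdiff hY.1 le_rfl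
  · intro V hV
    simp only [Finset.mem_filter, Finset.mem_powerset] at hV ⊢
    exact ⟨Finset.union_subset (hV.trans Finset.sdiff_subset) hZJ, Finset.subset_union_right⟩
  · intro Y hY
    simp only [Finset.mem_filter] at hY
    exact Finset.sdiff_union_of_subset hY.2
  · intro V hV
    have hd : Disjoint V Z := Finset.disjoint_of_subset_left (Finset.mem_powerset.1 hV)
      Finset.sdiff_disjoint
    rw [Finset.union_sdiff_right, Finset.sdiff_eq_self_of_disjoint hd]
  · intro Y hY
    simp only [Finset.mem_filter, Finset.mem_powerset] at hY
    have h1 := Finset.card_le_card hY.1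
    have h2 := Finset.card_le_card hY.2
    rw [Finset.card_sdiff_of_subset hY.2, Finset.card_sdiff_of_subset hZJ]
    have e1 : J.card - Z.card - (Y.card - Z.card) = J.card - Y.card := by omega
    obtain ⟨d, hd⟩ := Nat.exists_eq_add_of_le h2
    rw [e1, hd]
    simp only [Nat.add_sub_cancel_left, pow_add, mul_pow]
    ring

/-- The random subset avoids `W` with probability `(1 - q) ^ |W|`, and given this it is a thinning
of `J \ W`. -/
lemma thin_sdiff_le [DecidableEq ι] {q : ℝ} (h0 : 0 ≤ q) (h1 : q ≤ 1) {J W : Finset ι} (hW : W ⊆ J)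
    {f : Finset ι → ℝ} (h : ∀ Y, 0 ≤ f Y) :
    (1 - q) ^ W.card * thin q (J \ W) f ≤ thin q J f := by
  unfold thin
  have h1' : 0 ≤ 1 - q := by linarith
  rw [Finset.mul_sum]
  refine le_trans (le_of_eq ?_) (Finset.sum_le_sum_of_subset_of_nonneg
    (Finset.powerset_mono.2 (Finset.sdiff_subset : J \ W ⊆ J)) fun Y _ _ => by
      have := h Y; positivity)
  refine Finset.sum_congr rfl fun Y hY => ?_
  have h2 := Finset.card_le_card (Finset.mem_powerset.1 hY)
  have h3 := Finset.card_le_card hW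
  rw [Finset.card_sdiff_of_subset hW] at h2 ⊢
  have : J.card - Y.card = W.card + (J.card - W.card - Y.card) := by omega
  rw [this, pow_add]
  ring

lemma thin_empty_indicator [DecidableEq ι] (q : ℝ) (J : Finset ι) :
    thin q J (fun Y => if Y = ∅ then 1 else 0) = (1 - q) ^ J.card := by
  unfold thin
  rw [Finset.sum_eq_single ∅]
  · simp
  · intro Y _ hY; simp [hY]
  · simp

end Thinning

/-! ### The total cost of avoiding one coordinate at all later scales -/

section LogSum

/-- The square root serves as a potential that makes the sum telescope. With `u`, `v` the two roots,
`-log (u ^ 2) ≤ 2 (1 - u) / u`, and `1 - u ≤ ρ ^ τ = K (u ^ 2 - v ^ 2) ≤ 2 K u (u - v)`. -/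
lemma neg_log_one_sub_pow_le {K : ℝ} (hK : 2 ≤ K) (τ : ℕ) :
    -Real.log (1 - (1 - 1 / K) ^ (τ + 1)) ≤
      4 * K * (√(1 - (1 - 1 / K) ^ (τ + 1)) - √(1 - (1 - 1 / K) ^ τ)) := by
  have hK0 : 0 < K := by linarith
  have hi : 1 / K ≤ 1 / 2 := by apply one_div_le_one_div_of_le <;> linarith
  have hi0 : 0 < 1 / K := by positivity
  set ρ := 1 - 1 / K with hρ
  have hρ0 : 0 < ρ := by linarith
  have hρ1 : ρ < 1 := by linarith
  have a1 : ρ ^ τ ≤ 1 := pow_le_one₀ hρ0.le hρ1.le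
  have a2 : ρ ^ (τ + 1) < 1 := pow_lt_one₀ hρ0.le hρ1 (by omega)
  have a3 : ρ ^ (τ + 1) ≤ ρ ^ τ := pow_le_pow_of_le_one hρ0.le hρ1.le (by omega)
  have a4 : 0 < ρ ^ (τ + 1) := by positivity
  set u := √(1 - ρ ^ (τ + 1)) with hu
  set v := √(1 - ρ ^ τ) with hv
  have hu0 : 0 < u := Real.sqrt_pos.2 (by linarith)
  have hv0 : 0 ≤ v := Real.sqrt_nonneg _
  have hu2 : u ^ 2 = 1 - ρ ^ (τ + 1) := Real.sq_sqrt (by linarith)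
  have hv2 : v ^ 2 = 1 - ρ ^ τ := Real.sq_sqrt (by linarith)
  have hvu : v ≤ u := Real.sqrt_le_sqrt (by linarith)
  rw [← hu2, Real.log_pow]
  have hlog : 1 - u⁻¹ ≤ Real.log u := Real.one_sub_inv_le_log_of_pos hu0
  have h1 : K * (u ^ 2 - v ^ 2) = ρ ^ τ := by
    rw [hu2, hv2, pow_succ, hρ]; field_simp; ring
  have h2 : ρ ^ τ ≤ K * (u - v) * (2 * u) := by
    rw [← h1]
    have : 0 ≤ K * (u - v) := mul_nonneg hK0.le (by linarith)
    nlinarith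
  have h3 : 1 - u ≤ ρ ^ τ := by nlinarith
  have h4 : u⁻¹ - 1 ≤ 2 * K * (u - v) := by
    have : u⁻¹ - 1 = (1 - u) / u := by field_simp
    rw [this, div_le_iff₀ hu0]; linarith
  push_cast
  linarith

lemma sum_neg_log_one_sub_pow_le {K : ℝ} (hK : 2 ≤ K) (n : ℕ) :
    ∑ τ ∈ Finset.range n, -Real.log (1 - (1 - 1 / K) ^ (τ + 1)) ≤ 4 * K := by
  refine (Finset.sum_le_sum fun τ _ => neg_log_one_sub_pow_le hK τ).trans ?_
  rw [← Finset.mul_sum, Finset.sum_range_sub (fun τ => √(1 - (1 - 1 / K) ^ τ))]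
  have hi : 1 / K ≤ 1 / 2 := by apply one_div_le_one_div_of_le <;> linarith
  have h0 : 0 ≤ (1 - 1 / K) ^ n := pow_nonneg (by linarith) _
  have : √(1 - (1 - 1 / K) ^ n) ≤ 1 := Real.sqrt_le_one.2 (by linarith)
  simp only [pow_zero, sub_self, Real.sqrt_zero, sub_zero]
  nlinarith

end LogSum

/-! ### Spread sets and entropy deficiency -/

section Spread

variable {ι β : Type*}

/-- All members of `G` agree outside `J`. -/
def IsConstOff (J : Finset ι) (G : Finset (ι → β)) : Prop :=
  ∀ x ∈ G, ∀ y ∈ G, ∀ i, i ∉ J → x i = y i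

/-- Every marginal of the uniform distribution on `H` on a set `W ⊆ J` of coordinates has all
its point masses at most `r ^ |W|`. -/
def IsSpread [DecidableEq β] (r : ℝ) (J : Finset ι) (H : Finset (ι → β)) : Prop :=
  ∀ W ⊆ J, W.Nonempty → ∀ w : ι → β,
    ((H.filter fun x => ∀ i ∈ W, x i = w i).card : ℝ) ≤ r ^ W.card * H.card

/-- The entropy deficiency of the uniform distribution on `G` within the words that are free on
`J` only. -/
noncomputable def deficiency [Fintype β] (J : Finset ι) (G : Finset (ι → β)) : ℝ :=
  J.card * Real.log (Fintype.card β) - Real.log G.card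

lemma IsConstOff.subset {J : Finset ι} {G H : Finset (ι → β)} (hG : IsConstOff J G)
    (h : H ⊆ G) : IsConstOff J H :=
  fun x hx y hy => hG x (h hx) y (h hy)

lemma IsConstOff.card_le [Fintype β] {J : Finset ι} {G : Finset (ι → β)} (hG : IsConstOff J G) :
    G.card ≤ Fintype.card β ^ J.card := by
  classical
  have : G.card ≤ (Finset.univ : Finset (J → β)).card := by
    refine Finset.card_le_card_of_injOn (fun x i => x i) (by simp) ?_
    intro x hx y hy hxy
    funext i
    by_cases hi : i ∈ J
    · exact congrFun hxy ⟨i, hi⟩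
    · exact hG x hx y hy i hi
  simpa using this

lemma IsConstOff.deficiency_nonneg [Fintype β] {J : Finset ι} {G : Finset (ι → β)}
    (hG : IsConstOff J G) (hne : G.Nonempty) : 0 ≤ deficiency J G := by
  have h1 : (G.card : ℝ) ≤ (Fintype.card β : ℝ) ^ J.card := by exact_mod_cast hG.card_le
  have h2 : (0 : ℝ) < G.card := by exact_mod_cast hne.card_pos
  have := Real.log_le_log h2 h1
  rw [Real.log_pow] at this
  unfold deficiency
  linarith

/-- The chain rule for entropy: the revealed part on `J \ Y` carries at most `|J \ Y| log |β|`, so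
the average deficiency of the fibres does not exceed that of `G`. The inequality `log z ≥ 1 - 1 /
z`, applied to each fibre, replaces convexity. -/
lemma IsConstOff.sum_deficiency_le [DecidableEq ι] [DecidableEq β] [Fintype β] {J Y : Finset ι} {G : Finset (ι → β)}
    (hG : IsConstOff J G) (hY : Y ⊆ J) :
    ∑ k : ↥(J \ Y) → β, ((G.filter fun x => (fun i : ↥(J \ Y) => x i) = k).card : ℝ) *
      deficiency Y (G.filter fun x => (fun i : ↥(J \ Y) => x i) = k) ≤
    G.card * deficiency J G := by
  rcases G.eq_empty_or_nonempty with rfl | hne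
  · simp
  have hsum : ∑ k : ↥(J \ Y) → β,
      ((G.filter fun x => (fun i : ↥(J \ Y) => x i) = k).card : ℝ) = G.card := by
    have := Finset.card_eq_sum_card_fiberwise (s := G) (t := Finset.univ)
      (f := fun (x : ι → β) (i : ↥(J \ Y)) => x i) (by simp)
    exact_mod_cast this.symm
  obtain ⟨x₀, hx₀⟩ := hne
  have hn : (0 : ℝ) < G.card := by exact_mod_cast Finset.card_pos.2 ⟨x₀, hx₀⟩
  set Q : ℝ := (Fintype.card β : ℝ) ^ (J \ Y).card with hQ
  have hcardk : ((Finset.univ : Finset (↥(J \ Y) → β)).card : ℝ) = Q := by simp [hQ]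
  have hQ0 : 0 < Q := by
    rw [← hcardk]
    exact_mod_cast Finset.card_pos.2 ⟨fun i : ↥(J \ Y) => x₀ i, Finset.mem_univ _⟩
  have hlogQ : Real.log Q = (J.card - Y.card) * Real.log (Fintype.card β) := by
    rw [hQ, Real.log_pow, Finset.card_sdiff_of_subset hY, Nat.cast_sub (Finset.card_le_card hY)]
  have hterm : ∀ k : ↥(J \ Y) → β,
      ((G.filter fun x => (fun i : ↥(J \ Y) => x i) = k).card : ℝ) *
        deficiency Y (G.filter fun x => (fun i : ↥(J \ Y) => x i) = k) ≤
      ((G.filter fun x => (fun i : ↥(J \ Y) => x i) = k).card : ℝ) * (deficiency J G - 1) +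
        G.card / Q := by
    intro k
    set c : ℝ := ((G.filter fun x => (fun i : ↥(J \ Y) => x i) = k).card : ℝ) with hc
    have hc0 : 0 ≤ c := Nat.cast_nonneg _
    have hdiv : 0 ≤ G.card / Q := by positivity
    rcases hc0.eq_or_lt with h | hpos
    · simp only [← h]; simpa using hdiv
    · have h1 := Real.one_sub_inv_le_log_of_pos (x := c * Q / G.card) (by positivity)
      rw [Real.log_div (by positivity) hn.ne', Real.log_mul hpos.ne' hQ0.ne', hlogQ] at h1
      have h2 := mul_le_mul_of_nonneg_left h1 hpos.le
      have h3 : c * (1 - (c * Q / G.card)⁻¹) = c - G.card / Q := by field_simp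
      rw [h3] at h2
      unfold deficiency
      rw [← hc]
      linarith
  refine (Finset.sum_le_sum fun k _ => hterm k).trans ?_
  rw [Finset.sum_add_distrib, ← Finset.sum_mul, hsum, Finset.sum_const, nsmul_eq_mul, hcardk]
  have : Q * (G.card / Q) = G.card := by field_simp
  rw [this]
  linarith

end Spread

/-! ### Backward induction over the scales -/

section Induction

variable {ι β : Type*}

/-- The sum over the next `n` steps, with weights `w`, of the expected value of `err` when
`J` is thinned by the factor `ρ` in each step. -/
noncomputable def futureError (ρ : ℝ) (err : Finset ι → (ι → β) → ℝ) (n : ℕ) (w : ℕ → ℝ)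
    (J : Finset ι) (x : ι → β) : ℝ :=
  ∑ τ ∈ Finset.range n, w τ * thin (ρ ^ τ) J (fun Y => err Y x)

lemma futureError_succ [DecidableEq ι] (ρ : ℝ) (err : Finset ι → (ι → β) → ℝ) (n : ℕ) (w : ℕ → ℝ)
    (J : Finset ι) (x : ι → β) :
    futureError ρ err (n + 1) w J x =
      w 0 * err J x + thin ρ J (fun Y => futureError ρ err n (fun τ => w (τ + 1)) Y x) := by
  unfold futureError
  rw [Finset.sum_range_succ', ← thin_sum, add_comm]
  simp only [pow_zero, thin_one, thin_mul_left, thin_thin, pow_succ']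

/-- The lower bound on future errors at one stage of the backward induction. -/
def FutureErrorBound [Fintype β] (K α ρ : ℝ) (err : Finset ι → (ι → β) → ℝ) (n : ℕ) : Prop :=
  ∀ Λ : ℕ → ℝ, (∀ τ, 0 ≤ Λ τ) → ∀ (J : Finset ι) (G : Finset (ι → β)), IsConstOff J G →
    Real.exp (-K) * G.card * (∑ τ ∈ Finset.range n, (1 / 8 - Λ τ / K) - α * deficiency J G) ≤
      ∑ x ∈ G, futureError ρ err n (fun τ => Real.exp (-Λ τ)) J x

/-- Revealing a random part of the word does not spoil the bound. -/
lemma FutureErrorBound.thin [DecidableEq ι] [DecidableEq β] [Fintype β] {K α ρ : ℝ} {err : Finset ι → (ι → β) → ℝ} {n : ℕ}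
    (h : FutureErrorBound K α ρ err n) (hα : 0 ≤ α) (hρ0 : 0 ≤ ρ) (hρ1 : ρ ≤ 1)
    {Λ : ℕ → ℝ} (hΛ : ∀ τ, 0 ≤ Λ τ) {J : Finset ι} {G : Finset (ι → β)} (hG : IsConstOff J G) :
    Real.exp (-K) * G.card * (∑ τ ∈ Finset.range n, (1 / 8 - Λ τ / K) - α * deficiency J G) ≤
      ∑ x ∈ G, thin ρ J (fun Y => futureError ρ err n (fun τ => Real.exp (-Λ τ)) Y x) := by
  rw [thin_sum, ← thin_const ρ J (Real.exp (-K) * G.card *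
    (∑ τ ∈ Finset.range n, (1 / 8 - Λ τ / K) - α * deficiency J G))]
  refine thin_mono hρ0 hρ1 fun Y hY => ?_
  -- For fixed `Y` the letters on `J \ Y` become known. The hypothesis applies to each fibre, and
  -- the average deficiency has not grown.
  rw [← Finset.sum_fiberwise G (fun (x : ι → β) (i : ↥(J \ Y)) => x i)]
  set C := ∑ τ ∈ Finset.range n, (1 / 8 - Λ τ / K) with hC
  have hfib : ∀ k : ↥(J \ Y) → β,
      IsConstOff Y (G.filter fun x => (fun i : ↥(J \ Y) => x i) = k) := by
    intro k x hx y hy i hi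
    rw [Finset.mem_filter] at hx hy
    by_cases hiJ : i ∈ J
    · exact congrFun (hx.2.trans hy.2.symm) ⟨i, Finset.mem_sdiff.2 ⟨hiJ, hi⟩⟩
    · exact hG x hx.1 y hy.1 i hiJ
  refine le_trans ?_ (Finset.sum_le_sum fun k _ => h Λ hΛ Y _ (hfib k))
  rw [← hC]
  have hsum : ∑ k : ↥(J \ Y) → β,
      ((G.filter fun x => (fun i : ↥(J \ Y) => x i) = k).card : ℝ) = G.card := by
    have := Finset.card_eq_sum_card_fiberwise (s := G) (t := Finset.univ)
      (f := fun (x : ι → β) (i : ↥(J \ Y)) => x i) (by simp)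
    exact_mod_cast this.symm
  have hd := hG.sum_deficiency_le hY
  have e1 : ∀ k : ↥(J \ Y) → β,
      Real.exp (-K) * ((G.filter fun x => (fun i : ↥(J \ Y) => x i) = k).card : ℝ) *
        (C - α * deficiency Y (G.filter fun x => (fun i : ↥(J \ Y) => x i) = k)) =
      Real.exp (-K) * (C * ((G.filter fun x => (fun i : ↥(J \ Y) => x i) = k).card : ℝ) -
        α * (((G.filter fun x => (fun i : ↥(J \ Y) => x i) = k).card : ℝ) *
          deficiency Y (G.filter fun x => (fun i : ↥(J \ Y) => x i) = k))) := fun k => by ring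
  simp_rw [e1]
  rw [← Finset.mul_sum, Finset.sum_sub_distrib, ← Finset.mul_sum, ← Finset.mul_sum, hsum, mul_assoc]
  refine mul_le_mul_of_nonneg_left ?_ (Real.exp_pos _).le
  have := mul_le_mul_of_nonneg_left hd hα
  linarith

/-- The bound on a piece of `G` that is constant on `W` and has noticeable size. -/
lemma FutureErrorBound.piece [DecidableEq ι] [DecidableEq β] [Fintype β] {K α ρ r : ℝ} {err : Finset ι → (ι → β) → ℝ} {n : ℕ}
    (h : FutureErrorBound K α ρ err n) (hα : 0 ≤ α) (hK : 2 ≤ K) (hρ : ρ = 1 - 1 / K)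
    (herr : ∀ J x, 0 ≤ err J x) (hr : 0 < r) (hβ : 0 < Fintype.card β)
    (hgain : 4 ≤ α * Real.log (r * Fintype.card β))
    {Λ : ℕ → ℝ} (hΛ : ∀ τ, 0 ≤ Λ τ) {J W : Finset ι} (hW : W ⊆ J) (hWne : W.Nonempty)
    {G E : Finset (ι → β)} (hG : IsConstOff J G) (hGne : G.Nonempty) (hEG : E ⊆ G)
    (hE : ∀ x ∈ E, ∀ y ∈ E, ∀ i ∈ W, x i = y i) (hcard : r ^ W.card * G.card / 2 ≤ E.card) :
    Real.exp (-K) * E.card * (∑ τ ∈ Finset.range n, (1 / 8 - Λ (τ + 1) / K) - α * deficiency J G +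
        (α * Real.log (r * Fintype.card β) - 4 - α)) ≤
      ∑ x ∈ E, futureError ρ err (n + 1) (fun τ => Real.exp (-Λ τ)) J x := by
  have hK0 : 0 < K := by linarith
  have hi : 1 / K ≤ 1 / 2 := by apply one_div_le_one_div_of_le <;> linarith
  have hi0 : 0 < 1 / K := by positivity
  have hρ0 : 0 ≤ ρ := by linarith
  have hρ1 : ρ < 1 := by linarith
  have hEJ : IsConstOff (J \ W) E := by
    intro x hx y hy i hi
    by_cases hiW : i ∈ W
    · exact hE x hx y hy i hiW
    · exact hG x (hEG hx) y (hEG hy) i fun hiJ => hi (Finset.mem_sdiff.2 ⟨hiJ, hiW⟩)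
  set lam : ℕ → ℝ := fun τ => -Real.log (1 - ρ ^ (τ + 1)) with hlam
  have hpow : ∀ τ : ℕ, ρ ^ (τ + 1) < 1 := fun τ => pow_lt_one₀ hρ0 hρ1 (by omega)
  have hpow0 : ∀ τ : ℕ, 0 ≤ ρ ^ (τ + 1) := fun τ => by positivity
  have hlam0 : ∀ τ, 0 ≤ lam τ := fun τ => by
    have := Real.log_nonpos (x := 1 - ρ ^ (τ + 1)) (by linarith [hpow τ]) (by linarith [hpow0 τ])
    simp only [hlam]; linarith
  have hlamsum : ∑ τ ∈ Finset.range n, lam τ ≤ 4 * K := by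
    simp only [hlam, hρ]; exact sum_neg_log_one_sub_pow_le hK n
  -- The extra exponent is the logarithmic cost, at each later scale, of the random set missing all
  -- of `W`.
  set Λ' : ℕ → ℝ := fun τ => Λ (τ + 1) + W.card * lam τ with hΛ'
  have hΛ'0 : ∀ τ, 0 ≤ Λ' τ := fun τ => by
    have := hΛ (τ + 1); have := hlam0 τ; positivity
  have hIH := h.thin hα hρ0 hρ1.le hΛ'0 hEJ
  have hstep : ∀ x ∈ E,
      _root_.thin ρ (J \ W) (fun Y => futureError ρ err n (fun τ => Real.exp (-Λ' τ)) Y x) ≤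
        futureError ρ err (n + 1) (fun τ => Real.exp (-Λ τ)) J x := by
    intro x _
    unfold futureError
    -- The current scale is discarded: there the set is `J` itself, which contains `W`. Hence the
    -- exponents `τ + 1` in `lam`.
    rw [Finset.sum_range_succ', ← thin_sum]
    refine le_add_of_le_of_nonneg (Finset.sum_le_sum fun τ _ => ?_)
      (mul_nonneg (Real.exp_pos _).le (thin_nonneg (by simp) (by simp) fun Y => herr Y x))
    rw [thin_mul_left, thin_thin, ← pow_succ']
    have h1 : Real.exp (-Λ' τ) = Real.exp (-Λ (τ + 1)) * (1 - ρ ^ (τ + 1)) ^ W.card := by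
      have : (0 : ℝ) < 1 - ρ ^ (τ + 1) := by linarith [hpow τ]
      rw [← Real.exp_log (pow_pos this W.card), ← Real.exp_add, Real.log_pow]
      congr 1; simp only [hΛ', hlam]; ring
    beta_reduce
    rw [h1, mul_assoc]
    exact mul_le_mul_of_nonneg_left (thin_sdiff_le (hpow0 τ) (hpow τ).le hW fun Y => herr Y x)
      (Real.exp_pos _).le
  refine le_trans ?_ (hIH.trans (Finset.sum_le_sum hstep))
  refine mul_le_mul_of_nonneg_left ?_ (mul_nonneg (Real.exp_pos _).le (Nat.cast_nonneg _))
  have hW1 : (1 : ℝ) ≤ W.card := by exact_mod_cast hWne.card_pos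
  have hC : ∑ τ ∈ Finset.range n, (1 / 8 - Λ (τ + 1) / K) - 4 * W.card ≤
      ∑ τ ∈ Finset.range n, (1 / 8 - Λ' τ / K) := by
    have e : ∀ τ, 1 / 8 - Λ' τ / K = (1 / 8 - Λ (τ + 1) / K) - W.card / K * lam τ := fun τ => by
      simp only [hΛ']; ring
    simp_rw [e]
    rw [Finset.sum_sub_distrib (fun τ => 1 / 8 - Λ (τ + 1) / K), ← Finset.mul_sum]
    have : (W.card : ℝ) / K * ∑ τ ∈ Finset.range n, lam τ ≤ W.card / K * (4 * K) :=
      mul_le_mul_of_nonneg_left hlamsum (by positivity)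
    have e2 : (W.card : ℝ) / K * (4 * K) = 4 * W.card := by field_simp
    linarith
  have hGpos : (0 : ℝ) < G.card := by exact_mod_cast hGne.card_pos
  have hβ' : (0 : ℝ) < Fintype.card β := by exact_mod_cast hβ
  have hD : deficiency (J \ W) E ≤
      deficiency J G - W.card * Real.log (r * Fintype.card β) + 1 := by
    have h1 := Real.log_le_log (by positivity) hcard
    rw [Real.log_div (by positivity) (by norm_num), Real.log_mul (by positivity) hGpos.ne',
      Real.log_pow] at h1
    have h2 : Real.log 2 ≤ 1 := by linarith [Real.log_two_lt_d9]
    unfold deficiency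
    rw [Real.log_mul hr.ne' hβ'.ne', Finset.card_sdiff_of_subset hW,
      Nat.cast_sub (Finset.card_le_card hW)]
    linarith
  have hD' := mul_le_mul_of_nonneg_left hD hα
  -- The net gain per coordinate of `W` is nonnegative, so the worst case is `|W| = 1`; the separate
  -- `α` pays for the factor `1 / 2` in `hcard`.
  have : 0 ≤ ((W.card : ℝ) - 1) * (α * Real.log (r * Fintype.card β) - 4) :=
    mul_nonneg (by linarith) (by linarith)
  linarith

/-- The margin in `hgain` is set by the non-spread case: pieces covering half of `G` must pay `1 /
8` for the current scale and `α` for the increased deficiency of the leftover, and `(1 / 4 + 2 * α)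
/ 2` is exactly that. -/
lemma futureErrorBound [DecidableEq β] [Fintype β] {K α ρ r : ℝ} {err : Finset ι → (ι → β) → ℝ}
    (hα : 0 ≤ α) (hK : 2 ≤ K) (hρ : ρ = 1 - 1 / K)
    (herr : ∀ J x, 0 ≤ err J x) (hr : 0 < r) (hβ : 0 < Fintype.card β)
    (hgain : 17 / 4 + 3 * α ≤ α * Real.log (r * Fintype.card β))
    (hspread : ∀ J H, IsConstOff J H → IsSpread r J H → (H.card : ℝ) / 4 ≤ ∑ x ∈ H, err J x)
    (n : ℕ) : FutureErrorBound K α ρ err n := by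
  classical
  have hK0 : 0 < K := by linarith
  have hi : 1 / K ≤ 1 / 2 := by apply one_div_le_one_div_of_le <;> linarith
  have hi0 : 0 < 1 / K := by positivity
  have hρ0 : 0 ≤ ρ := by linarith
  have hρ1 : ρ < 1 := by linarith
  have hexpK := Real.exp_pos (-K)
  induction n with
  | zero =>
    intro Λ _ J G hG
    rcases G.eq_empty_or_nonempty with rfl | hne
    · simp
    have := mul_nonneg hα (hG.deficiency_nonneg hne)
    have : 0 ≤ Real.exp (-K) * G.card * (α * deficiency J G) := by positivity
    simp only [futureError, Finset.range_zero, Finset.sum_empty, Finset.sum_const_zero]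
    linarith
  | succ n ih =>
    intro Λ hΛ J G hG
    rcases G.eq_empty_or_nonempty with rfl | hne
    · simp
    have hGpos : (0 : ℝ) < G.card := by exact_mod_cast hne.card_pos
    have hthin := fun {H : Finset (ι → β)} (hH : IsConstOff J H) =>
      ih.thin hα hρ0 hρ1.le (Λ := fun τ => Λ (τ + 1)) (fun τ => hΛ (τ + 1)) hH
    rw [Finset.sum_range_succ']
    set C := ∑ τ ∈ Finset.range n, (1 / 8 - Λ (τ + 1) / K) with hC
    have hΛK : 0 ≤ Λ 0 / K := div_nonneg (hΛ 0) hK0.le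
    by_cases hex : ∃ H ⊆ G, (G.card : ℝ) ≤ 2 * H.card ∧ IsSpread r J H
    · obtain ⟨H, hHG, hHcard, hH⟩ := hex
      simp_rw [futureError_succ]
      rw [Finset.sum_add_distrib, ← Finset.mul_sum]
      have h1 := hthin hG
      have h2 : (G.card : ℝ) / 8 ≤ ∑ x ∈ G, err J x := by
        have := hspread J H (hG.subset hHG) hH
        have := Finset.sum_le_sum_of_subset_of_nonneg hHG (f := err J) fun x _ _ => herr J x
        linarith
      have h3 : Real.exp (-K) * G.card * (1 / 8 - Λ 0 / K) ≤
          Real.exp (-Λ 0) * ∑ x ∈ G, err J x := by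
        -- If `Λ 0 ≥ K`, the claimed contribution of this scale is not positive; otherwise its
        -- weight is at least `exp (-K)`.
        rcases le_total (Λ 0) K with hle | hle
        · have e1 : Real.exp (-K) ≤ Real.exp (-Λ 0) := Real.exp_le_exp.2 (by linarith)
          calc Real.exp (-K) * G.card * (1 / 8 - Λ 0 / K)
              ≤ Real.exp (-K) * G.card * (1 / 8) :=
                mul_le_mul_of_nonneg_left (by linarith) (by positivity)
            _ = Real.exp (-K) * (G.card / 8) := by ring
            _ ≤ _ := mul_le_mul e1 h2 (by positivity) (Real.exp_pos _).le
        · have : 1 ≤ Λ 0 / K := (one_le_div hK0).2 hle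
          have e1 : Real.exp (-K) * G.card * (1 / 8 - Λ 0 / K) ≤ 0 :=
            mul_nonpos_of_nonneg_of_nonpos (by positivity) (by linarith)
          have e2 : 0 ≤ Real.exp (-Λ 0) * ∑ x ∈ G, err J x :=
            mul_nonneg (Real.exp_pos _).le (by linarith [hGpos])
          linarith
      linarith
    · push Not at hex
      set v := Real.exp (-K) *
        (C - α * deficiency J G + (α * Real.log (r * Fintype.card β) - 4 - α)) with hv
      set fut : (ι → β) → ℝ :=
        fun x => futureError ρ err (n + 1) (fun τ => Real.exp (-Λ τ)) J x with hfut
      -- Pieces are removed greedily while the leftover `H` has at least half of `G`: such an `H` is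
      -- not spread, so it contains a further piece. The removed part satisfies the bound `v` per
      -- word.
      have hwf : ∀ c : ℕ, ∀ H ⊆ G, H.card = c → ((G \ H).card : ℝ) * v ≤ ∑ x ∈ G \ H, fut x →
          ∃ H' ⊆ G, 2 * (H'.card : ℝ) < G.card ∧
            ((G \ H').card : ℝ) * v ≤ ∑ x ∈ G \ H', fut x := by
        intro c
        induction c using Nat.strong_induction_on with
        | _ c ihc =>
          intro H hHG hHc hH
          by_cases hlt : 2 * (H.card : ℝ) < G.card
          · exact ⟨H, hHG, hlt, hH⟩
          push Not at hlt
          have hns := hex H hHG hlt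
          unfold IsSpread at hns
          push Not at hns
          obtain ⟨W, hWJ, hWne, w, hw⟩ := hns
          set E := H.filter fun x => ∀ i ∈ W, x i = w i with hE
          have hEH : E ⊆ H := Finset.filter_subset _ _
          have hHpos : (0 : ℝ) < H.card := by linarith
          have hEcard : r ^ W.card * G.card / 2 ≤ E.card := by
            have : r ^ W.card * (G.card / 2) ≤ r ^ W.card * H.card :=
              mul_le_mul_of_nonneg_left (by linarith) (by positivity)
            linarith
          have hEpos : 0 < E.card := by
            have : (0 : ℝ) < E.card := lt_of_le_of_lt (by positivity) hw
            exact_mod_cast this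
          have hpiece := ih.piece hα hK hρ herr hr hβ (by linarith) hΛ hWJ hWne hG hne
            (hEH.trans hHG) (E := E) (by
              intro x hx y hy i hi
              rw [hE, Finset.mem_filter] at hx hy
              rw [hx.2 i hi, hy.2 i hi]) hEcard
          have hsplit : G \ (H \ E) = (G \ H) ∪ E := by
            ext x
            simp only [Finset.mem_sdiff, Finset.mem_union]
            have := @hEH x
            have := @hHG x
            tauto
          have hdisj : Disjoint (G \ H) E :=
            Finset.disjoint_of_subset_right hEH Finset.sdiff_disjoint
          refine ihc (H \ E).card ?_ (H \ E) (Finset.sdiff_subset.trans hHG) rfl ?_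
          · rw [← hHc]
            have := Finset.card_sdiff_add_card_eq_card hEH
            omega
          · rw [hsplit, Finset.sum_union hdisj, Finset.card_union_of_disjoint hdisj]
            push_cast
            have e : Real.exp (-K) * E.card * (C - α * deficiency J G +
              (α * Real.log (r * Fintype.card β) - 4 - α)) = E.card * v := by rw [hv]; ring
            rw [e] at hpiece
            linarith
      obtain ⟨H, hHG, hHlt, hH⟩ := hwf G.card G le_rfl rfl (by simp)
      have hleft : Real.exp (-K) * (H.card * (C - α * deficiency J G) - α * G.card) ≤
          ∑ x ∈ H, fut x := by
        have h1 := hthin (hG.subset hHG)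
        have h2 : ∑ x ∈ H, _root_.thin ρ J
            (fun Y => futureError ρ err n (fun τ => Real.exp (-Λ (τ + 1))) Y x) ≤
            ∑ x ∈ H, fut x := by
          refine Finset.sum_le_sum fun x _ => ?_
          simp only [hfut]
          rw [futureError_succ]
          have := mul_nonneg (Real.exp_pos (-Λ 0)).le (herr J x)
          linarith
        refine le_trans ?_ (h1.trans h2)
        rw [mul_assoc]
        refine mul_le_mul_of_nonneg_left ?_ hexpK.le
        -- A small leftover may have large deficiency, but `|H| log (|G| / |H|) ≤ |G|` bounds the
        -- weighted loss.
        have h3 : (H.card : ℝ) * deficiency J H ≤ H.card * deficiency J G + G.card := by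
          rcases H.eq_empty_or_nonempty with rfl | hHne
          · simp
          have hHpos : (0 : ℝ) < H.card := by exact_mod_cast hHne.card_pos
          have := Real.log_le_sub_one_of_pos (x := (G.card : ℝ) / H.card) (by positivity)
          rw [Real.log_div hGpos.ne' hHpos.ne'] at this
          have h4 := mul_le_mul_of_nonneg_left this hHpos.le
          have h5 : (H.card : ℝ) * (G.card / H.card - 1) = G.card - H.card := by field_simp
          rw [h5] at h4
          unfold deficiency
          linarith
        have := mul_le_mul_of_nonneg_left h3 hα
        linarith
      have hsum : ∑ x ∈ G, fut x = ∑ x ∈ G \ H, fut x + ∑ x ∈ H, fut x :=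
        (Finset.sum_sdiff hHG).symm
      have hcards : ((G \ H).card : ℝ) + H.card = G.card := by
        exact_mod_cast Finset.card_sdiff_add_card_eq_card hHG
      rw [hsum]
      refine le_trans ?_ (add_le_add hH hleft)
      have hgc : ((G \ H).card : ℝ) = G.card - H.card := by linarith
      rw [hgc, hv]
      have e1 : ((G.card : ℝ) - H.card) * (Real.exp (-K) * (C - α * deficiency J G +
          (α * Real.log (r * Fintype.card β) - 4 - α))) +
          Real.exp (-K) * (H.card * (C - α * deficiency J G) - α * G.card) =
          Real.exp (-K) * (G.card * (C - α * deficiency J G) +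
            (((G.card : ℝ) - H.card) * (α * Real.log (r * Fintype.card β) - 4 - α)
              - α * G.card)) := by ring
      rw [e1, mul_assoc]
      refine mul_le_mul_of_nonneg_left ?_ hexpK.le
      have h6 : (G.card : ℝ) / 2 * (α * Real.log (r * Fintype.card β) - 4 - α) ≤
          ((G.card : ℝ) - H.card) * (α * Real.log (r * Fintype.card β) - 4 - α) :=
        mul_le_mul_of_nonneg_right (by linarith) (by linarith)
      have h7 : (G.card : ℝ) / 2 * (17 / 4 + 3 * α - 4 - α) ≤
          (G.card : ℝ) / 2 * (α * Real.log (r * Fintype.card β) - 4 - α) :=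
        mul_le_mul_of_nonneg_left (by linarith) (by positivity)
      have h8 : 0 ≤ (G.card : ℝ) * (Λ 0 / K) := by positivity
      linarith

end Induction

/-! ### Random colourings made constant on a set -/

section Colouring

variable {κ : Type*} [DecidableEq κ]

/-- The colouring `P` changed to the constant colour `σ` on `A`. -/
def recolour (P : κ → Bool) (A : Finset κ) (σ : Bool) : κ → Bool :=
  fun u => if u ∈ A then σ else P u

variable [Fintype κ]

lemma card_filter_eq_on (A : Finset κ) (σ : Bool) :
    ((Finset.univ : Finset (κ → Bool)).filter fun P => ∀ u ∈ A, P u = σ).card =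
      2 ^ (Fintype.card κ - A.card) := by
  have : (Finset.univ : Finset (κ → Bool)).filter (fun P => ∀ u ∈ A, P u = σ) =
      Fintype.piFinset fun u => if u ∈ A then {σ} else Finset.univ := by
    ext P
    simp only [Finset.mem_filter, Finset.mem_univ, true_and, Fintype.mem_piFinset]
    refine forall_congr' fun u => ?_
    by_cases hu : u ∈ A <;> simp [hu]
  rw [this, Fintype.card_piFinset, ← Finset.card_compl]
  have e : ∀ u, (if u ∈ A then ({σ} : Finset Bool) else Finset.univ).card =
      if u ∈ Aᶜ then 2 else 1 := fun u => by by_cases hu : u ∈ A <;> simp [hu]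
  simp_rw [e]
  rw [Finset.prod_ite_mem, Finset.univ_inter, Finset.prod_const]

lemma card_filter_recolour_eq (A : Finset κ) (σ : Bool) (Q : κ → Bool) :
    ((Finset.univ : Finset (κ → Bool)).filter fun P => recolour P A σ = Q).card =
      if ∀ u ∈ A, Q u = σ then 2 ^ A.card else 0 := by
  split_ifs with h
  · have : (Finset.univ : Finset (κ → Bool)).filter (fun P => recolour P A σ = Q) =
        Fintype.piFinset fun u => if u ∈ A then Finset.univ else {Q u} := by
      ext P
      simp only [Finset.mem_filter, Finset.mem_univ, true_and, Fintype.mem_piFinset, funext_iff,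
        recolour]
      refine forall_congr' fun u => ?_
      by_cases hu : u ∈ A
      · simp [hu, h u hu]
      · simp [hu]
    rw [this, Fintype.card_piFinset]
    have e : ∀ u, (if u ∈ A then (Finset.univ : Finset Bool) else {Q u}).card =
        if u ∈ A then 2 else 1 := fun u => by by_cases hu : u ∈ A <;> simp [hu]
    simp_rw [e]
    rw [Finset.prod_ite_mem, Finset.univ_inter, Finset.prod_const]
  · rw [Finset.card_eq_zero, Finset.filter_eq_empty_iff]
    rintro P - rfl
    exact h fun u hu => by simp [recolour, hu]

/-- Recolouring has density `2 ^ |A|` on the colourings that are constantly `σ` on `A`. This change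
of measure moves the dependence on the word from the colouring to a weight. -/
lemma sum_recolour (A : Finset κ) (σ : Bool) (f : (κ → Bool) → ℝ) :
    ∑ P, f (recolour P A σ) = ∑ P, if ∀ u ∈ A, P u = σ then 2 ^ A.card * f P else 0 := by
  rw [← Finset.sum_fiberwise Finset.univ (fun P => recolour P A σ)]
  refine Finset.sum_congr rfl fun Q _ => ?_
  have : ∀ P ∈ (Finset.univ : Finset (κ → Bool)).filter (fun P => recolour P A σ = Q),
      f (recolour P A σ) = f Q := fun P hP => by rw [(Finset.mem_filter.1 hP).2]
  rw [Finset.sum_congr rfl this, Finset.sum_const, card_filter_recolour_eq, nsmul_eq_mul]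
  split_ifs <;> simp

end Colouring

/-! ### Second moment method: spread sets hide the colour -/

section SecondMoment

variable {ι β : Type*} [DecidableEq β]

/-- The points of the graph of `x` over `J`. -/
def graphOn [DecidableEq ι] (J : Finset ι) (x : ι → β) : Finset (ι × β) :=
  J.image fun i => (i, x i)

lemma mem_graphOn [DecidableEq ι] {J : Finset ι} {x : ι → β} {p : ι × β} :
    p ∈ graphOn J x ↔ p.1 ∈ J ∧ x p.1 = p.2 := by
  simp only [graphOn, Finset.mem_image]
  constructor
  · rintro ⟨i, hi, rfl⟩; exact ⟨hi, rfl⟩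
  · rintro ⟨h1, h2⟩; exact ⟨p.1, h1, by rw [h2]⟩

lemma card_graphOn [DecidableEq ι] (J : Finset ι) (x : ι → β) : (graphOn J x).card = J.card :=
  Finset.card_image_of_injective _ fun _ _ h => (Prod.ext_iff.1 h).1

lemma card_graphOn_inter [DecidableEq ι] (J : Finset ι) (x y : ι → β) :
    (graphOn J x ∩ graphOn J y).card = (J.filter fun i => x i = y i).card := by
  rw [← card_graphOn (J.filter fun i => x i = y i) x]
  congr 1
  ext p
  simp only [Finset.mem_inter, mem_graphOn, Finset.mem_filter]
  constructor
  · rintro ⟨⟨h1, h2⟩, -, h4⟩; exact ⟨⟨h1, h2.trans h4.symm⟩, h2⟩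
  · rintro ⟨⟨h1, h2⟩, h3⟩; exact ⟨⟨h1, h3⟩, h1, h2.symm.trans h3⟩

/-- Two independent members of a spread set rarely agree. -/
lemma IsSpread.sum_two_pow_agree_le {r : ℝ} {J : Finset ι} {H : Finset (ι → β)}
    (hH : IsSpread r J H) :
    ∑ x ∈ H, ∑ y ∈ H, (2 : ℝ) ^ (J.filter fun i => x i = y i).card ≤
      (H.card : ℝ) ^ 2 * (1 + r) ^ J.card := by
  -- `2 ^ k` counts the subsets `V` of the agreement set, and spreadness bounds the number of `y`
  -- agreeing with `x` on `V`.
  have e : ∀ x y : ι → β, (2 : ℝ) ^ (J.filter fun i => x i = y i).card =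
      ∑ V ∈ J.powerset, if ∀ i ∈ V, y i = x i then (1 : ℝ) else 0 := by
    intro x y
    rw [Finset.sum_boole]
    have : J.powerset.filter (fun V => ∀ i ∈ V, y i = x i) =
        (J.filter fun i => x i = y i).powerset := by
      ext V
      simp only [Finset.mem_filter, Finset.mem_powerset, Finset.subset_iff]
      constructor
      · rintro ⟨h1, h2⟩ i hi; exact ⟨h1 hi, (h2 i hi).symm⟩
      · intro h; exact ⟨fun i hi => (h hi).1, fun i hi => (h hi).2.symm⟩
    rw [this, Finset.card_powerset]
    simp
  simp_rw [e]
  have hin : ∀ x ∈ H, ∑ y ∈ H, ∑ V ∈ J.powerset, (if ∀ i ∈ V, y i = x i then (1 : ℝ) else 0) ≤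
      H.card * (1 + r) ^ J.card := by
    intro x _
    rw [Finset.sum_comm]
    have hb : ∀ V ∈ J.powerset, ∑ y ∈ H, (if ∀ i ∈ V, y i = x i then (1 : ℝ) else 0) ≤
        r ^ V.card * H.card := by
      intro V hV
      rw [Finset.sum_boole]
      rcases V.eq_empty_or_nonempty with rfl | hne
      · simp
      · exact hH V (Finset.mem_powerset.1 hV) hne x
    refine (Finset.sum_le_sum hb).trans (le_of_eq ?_)
    rw [← Finset.sum_mul, mul_comm, add_comm 1 r, ← Finset.sum_pow_mul_eq_add_pow]
    simp
  refine (Finset.sum_le_sum hin).trans (le_of_eq ?_)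
  rw [Finset.sum_const, nsmul_eq_mul]
  ring

variable [DecidableEq ι] [Fintype ι] [Fintype β]

/-- The normalized number of members of `H` whose graph over `J` has colour `σ`. -/
noncomputable def monochromaticMass (J : Finset ι) (H : Finset (ι → β)) (σ : Bool)
    (P : ι × β → Bool) : ℝ :=
  ∑ x ∈ H, if ∀ u ∈ graphOn J x, P u = σ then (2 : ℝ) ^ J.card else 0

lemma sum_ite_eq_on (A : Finset (ι × β)) (σ : Bool) (c : ℝ) :
    ∑ P : ι × β → Bool, (if ∀ u ∈ A, P u = σ then c else 0) =
      c * (2 ^ Fintype.card (ι × β) / 2 ^ A.card) := by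
  rw [← Finset.sum_filter, Finset.sum_const, card_filter_eq_on, nsmul_eq_mul, mul_comm]
  push_cast
  rw [pow_sub₀ _ two_ne_zero (Finset.card_le_univ A), div_eq_mul_inv]

lemma sum_monochromaticMass (J : Finset ι) (H : Finset (ι → β)) (σ : Bool) :
    ∑ P, monochromaticMass J H σ P = 2 ^ Fintype.card (ι × β) * H.card := by
  unfold monochromaticMass
  rw [Finset.sum_comm]
  simp_rw [sum_ite_eq_on, card_graphOn]
  rw [Finset.sum_const, nsmul_eq_mul]
  field_simp

lemma sum_monochromaticMass_sq (J : Finset ι) (H : Finset (ι → β)) (σ : Bool) :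
    ∑ P, monochromaticMass J H σ P ^ 2 = 2 ^ Fintype.card (ι × β) *
      ∑ x ∈ H, ∑ y ∈ H, (2 : ℝ) ^ (J.filter fun i => x i = y i).card := by
  unfold monochromaticMass
  simp_rw [sq, Finset.sum_mul_sum]
  rw [Finset.sum_comm, Finset.mul_sum]
  refine Finset.sum_congr rfl fun x _ => ?_
  rw [Finset.sum_comm, Finset.mul_sum]
  refine Finset.sum_congr rfl fun y _ => ?_
  have e : ∀ P : ι × β → Bool, (if ∀ u ∈ graphOn J x, P u = σ then (2 : ℝ) ^ J.card else 0) *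
      (if ∀ u ∈ graphOn J y, P u = σ then (2 : ℝ) ^ J.card else 0) =
      if ∀ u ∈ graphOn J x ∪ graphOn J y, P u = σ then (2 : ℝ) ^ J.card * 2 ^ J.card else 0 := by
    intro P
    rw [ite_zero_mul_ite_zero]
    congr 1
    simp only [Finset.mem_union, or_imp, forall_and]
  simp_rw [e]
  rw [sum_ite_eq_on]
  have h := Finset.card_union_add_card_inter (graphOn J x) (graphOn J y)
  rw [card_graphOn, card_graphOn, card_graphOn_inter] at h
  have h2 : (2 : ℝ) ^ J.card * 2 ^ J.card = 2 ^ (graphOn J x ∪ graphOn J y).card *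
      2 ^ (J.filter fun i => x i = y i).card := by rw [← pow_add, ← pow_add, h]
  rw [h2]
  field_simp

/-- The probability that the guess `b`, made from `J`, from the part of `x` outside `J` and from a
colouring that is constant on the graph of `x` over `J` and random elsewhere, differs from that
constant. For empty `J` the value is `1`. -/
noncomputable def guessError (b : Finset ι → (ι → β) → (ι × β → Bool) → Bool)
    (J : Finset ι) (x : ι → β) : ℝ :=
  if J = ∅ then 1 else
    1 / 2 * (1 / 2 ^ Fintype.card (ι × β)) * ∑ σ : Bool, ∑ P : ι × β → Bool,
      if b J x (recolour P (graphOn J x) σ) ≠ σ then 1 else 0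

lemma guessError_nonneg (b : Finset ι → (ι → β) → (ι × β → Bool) → Bool)
    (J : Finset ι) (x : ι → β) : 0 ≤ guessError b J x := by
  unfold guessError
  split_ifs
  · norm_num
  · refine mul_nonneg (by positivity) (Finset.sum_nonneg fun σ _ => Finset.sum_nonneg fun P _ => ?_)
    split_ifs <;> norm_num

/-- The mass has mean `|H|` and variance at most `|H| ^ 2 / 16`. The bound `z ≤ |H| / 8 + 2 z ^ 2 /
|H|` turns this into a first-moment bound. -/
lemma sum_abs_monochromaticMass_sub_le {r : ℝ} {J : Finset ι}
    (hrJ : (1 + r) ^ J.card ≤ 17 / 16) {H : Finset (ι → β)} (hH : IsSpread r J H) (σ : Bool) :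
    ∑ P, |monochromaticMass J H σ P - H.card| ≤
      2 ^ Fintype.card (ι × β) * ((H.card : ℝ) / 4) := by
  rcases H.eq_empty_or_nonempty with rfl | hne
  · simp [monochromaticMass]
  have hpos : (0 : ℝ) < H.card := by exact_mod_cast hne.card_pos
  have h1 : ∀ P ∈ (Finset.univ : Finset (ι × β → Bool)), |monochromaticMass J H σ P - H.card| ≤
      H.card / 8 + 2 / H.card * (monochromaticMass J H σ P ^ 2
        - 2 * H.card * monochromaticMass J H σ P + H.card ^ 2) := by
    intro P _
    set z := |monochromaticMass J H σ P - H.card| with hz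
    have e : monochromaticMass J H σ P ^ 2 - 2 * H.card * monochromaticMass J H σ P + H.card ^ 2 =
        z ^ 2 := by rw [hz, sq_abs]; ring
    rw [e]
    have : H.card / 8 + 2 / H.card * z ^ 2 - z = 2 / H.card * (z - H.card / 4) ^ 2 := by
      field_simp; ring
    have h2 : 0 ≤ 2 / (H.card : ℝ) * (z - H.card / 4) ^ 2 := by positivity
    linarith
  refine (Finset.sum_le_sum h1).trans ?_
  rw [Finset.sum_add_distrib, ← Finset.mul_sum, Finset.sum_add_distrib, Finset.sum_sub_distrib,
    ← Finset.mul_sum, sum_monochromaticMass, sum_monochromaticMass_sq, Finset.sum_const,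
    Finset.sum_const, Finset.card_univ, Fintype.card_fun, Fintype.card_bool, nsmul_eq_mul,
    nsmul_eq_mul]
  push_cast
  set Q : ℝ := 2 ^ Fintype.card (ι × β) with hQ
  have hQ0 : 0 < Q := by positivity
  have h3 := hH.sum_two_pow_agree_le
  have h4 : (H.card : ℝ) ^ 2 * (1 + r) ^ J.card ≤ H.card ^ 2 * (17 / 16) :=
    mul_le_mul_of_nonneg_left hrJ (by positivity)
  have h5 : Q * ∑ x ∈ H, ∑ y ∈ H, (2 : ℝ) ^ (J.filter fun i => x i = y i).card -
      2 * H.card * (Q * H.card) + Q * H.card ^ 2 ≤ Q * H.card ^ 2 / 16 := by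
    have := mul_le_mul_of_nonneg_left (h3.trans h4) hQ0.le
    linarith
  have h6 := mul_le_mul_of_nonneg_left h5 (show 0 ≤ 2 / (H.card : ℝ) by positivity)
  have h7 : 2 / (H.card : ℝ) * (Q * H.card ^ 2 / 16) = Q * (H.card / 8) := by
    field_simp; ring
  linarith

/-- On a spread set every guess errs with probability at least `1 / 4`. -/
lemma le_sum_guessError {b : Finset ι → (ι → β) → (ι × β → Bool) → Bool}
    (hb : ∀ J x y, (∀ i, i ∉ J → x i = y i) → b J x = b J y) {r : ℝ}
    {J : Finset ι} (hrJ : (1 + r) ^ J.card ≤ 17 / 16) {H : Finset (ι → β)} (hJ : IsConstOff J H)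
    (hH : IsSpread r J H) : (H.card : ℝ) / 4 ≤ ∑ x ∈ H, guessError b J x := by
  rcases H.eq_empty_or_nonempty with rfl | ⟨x₀, hx₀⟩
  · simp
  by_cases hJe : J = ∅
  · simp only [guessError, if_pos hJe, Finset.sum_const, nsmul_eq_mul, mul_one]
    have : (0 : ℝ) ≤ H.card := Nat.cast_nonneg _
    linarith
  simp only [guessError, if_neg hJe]
  set Q : ℝ := 2 ^ Fintype.card (ι × β) with hQ
  have hQ0 : 0 < Q := by positivity
  have e1 : ∀ σ : Bool, ∀ x ∈ H, (∑ P : ι × β → Bool,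
      if b J x (recolour P (graphOn J x) σ) ≠ σ then (1 : ℝ) else 0) =
      ∑ P : ι × β → Bool, (if b J x₀ P ≠ σ then (1 : ℝ) else 0) *
        (if ∀ u ∈ graphOn J x, P u = σ then (2 : ℝ) ^ J.card else 0) := by
    intro σ x hx
    rw [hb J x x₀ (hJ x hx x₀ hx₀),
      sum_recolour (graphOn J x) σ (fun P => if b J x₀ P ≠ σ then (1 : ℝ) else 0), card_graphOn]
    refine Finset.sum_congr rfl fun P _ => ?_
    split_ifs <;> simp
  rw [← Finset.mul_sum, Finset.sum_comm]
  have e2 : ∀ σ : Bool, ∑ x ∈ H, (∑ P : ι × β → Bool,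
      if b J x (recolour P (graphOn J x) σ) ≠ σ then (1 : ℝ) else 0) =
      ∑ P : ι × β → Bool, (if b J x₀ P ≠ σ then (1 : ℝ) else 0) * monochromaticMass J H σ P := by
    intro σ
    rw [Finset.sum_congr rfl (e1 σ), Finset.sum_comm]
    simp_rw [← Finset.mul_sum]
    rfl
  simp_rw [e2]
  rw [Fintype.sum_bool, ← Finset.sum_add_distrib]
  -- For each colouring the guess is wrong for one of the two colours, whose mass is nearly `|H|`.
  have h1 : ∀ P ∈ (Finset.univ : Finset (ι × β → Bool)),
      (H.card : ℝ) - |monochromaticMass J H true P - H.card| -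
        |monochromaticMass J H false P - H.card| ≤
      (if b J x₀ P ≠ true then (1 : ℝ) else 0) * monochromaticMass J H true P +
        (if b J x₀ P ≠ false then (1 : ℝ) else 0) * monochromaticMass J H false P := by
    intro P _
    have a1 := neg_abs_le (monochromaticMass J H true P - H.card)
    have a2 := neg_abs_le (monochromaticMass J H false P - H.card)
    have a3 := abs_nonneg (monochromaticMass J H true P - H.card)
    have a4 := abs_nonneg (monochromaticMass J H false P - H.card)
    cases b J x₀ P <;> simp <;> linarith
  have h2 := Finset.sum_le_sum h1
  rw [Finset.sum_sub_distrib, Finset.sum_sub_distrib, Finset.sum_const, Finset.card_univ,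
    Fintype.card_fun, Fintype.card_bool, nsmul_eq_mul] at h2
  push_cast at h2
  rw [← hQ] at h2
  have h3 := sum_abs_monochromaticMass_sub_le hrJ hH true
  have h4 := sum_abs_monochromaticMass_sub_le hrJ hH false
  rw [← hQ] at h3 h4
  have h5 : Q * (H.card / 2) ≤ _ := le_trans (by linarith) h2
  have h6 := mul_le_mul_of_nonneg_left h5 (show 0 ≤ 1 / 2 * (1 / Q) by positivity)
  refine le_trans (le_of_eq ?_) h6
  field_simp
  norm_num

end SecondMoment

/-! ### The error bound for large sets of words -/

section WordBound

variable {ι β : Type*} [DecidableEq ι] [DecidableEq β] [Fintype ι] [Fintype β]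

lemma one_add_inv_pow_le {m k : ℕ} (hkm : k ≤ m) :
    (1 + 1 / (32 * m : ℝ)) ^ k ≤ 17 / 16 := by
  rcases Nat.eq_zero_or_pos m with rfl | hm
  · obtain rfl : k = 0 := by omega
    norm_num
  have hm0 : (0 : ℝ) < m := by exact_mod_cast hm
  have h1 : (1 + 1 / (32 * m : ℝ)) ≤ Real.exp (1 / (32 * m)) := by
    linarith [Real.add_one_le_exp (1 / (32 * m : ℝ))]
  have h2 : (1 + 1 / (32 * m : ℝ)) ^ k ≤ Real.exp (1 / (32 * m)) ^ k :=
    pow_le_pow_left₀ (by positivity) h1 k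
  refine h2.trans ?_
  rw [← Real.exp_nat_mul]
  have h3 : (k : ℝ) * (1 / (32 * m)) ≤ 1 / 32 := by
    have : (k : ℝ) ≤ m := by exact_mod_cast hkm
    rw [mul_one_div, div_le_iff₀ (by positivity)]
    linarith
  have h4 := Real.add_one_le_exp (-(1 / 32 : ℝ))
  have h5 : Real.exp (1 / 32) * Real.exp (-(1 / 32)) = 1 := by rw [← Real.exp_add]; simp
  have h6 := Real.exp_pos (1 / 32 : ℝ)
  refine (Real.exp_le_exp.2 h3).trans ?_
  nlinarith

/-- A large set of words forces many errors over the successive thinning scales. -/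
lemma le_sum_thin_guessError {b : Finset ι → (ι → β) → (ι × β → Bool) → Bool}
    (hb : ∀ J x y, (∀ i, i ∉ J → x i = y i) → b J x = b J y)
    (hm : 0 < Fintype.card ι) (hβ : Fintype.card β = (32 * Fintype.card ι) ^ 2)
    (hlog : 6 ≤ Real.log (32 * Fintype.card ι)) {K : ℝ} (hK : 2 ≤ K) (N : ℕ)
    (G : Finset (ι → β)) :
    Real.exp (-K) * G.card * (N / 8 - 9 / Real.log (32 * Fintype.card ι) *
        (Fintype.card ι * Real.log (Fintype.card β) - Real.log G.card)) ≤
      ∑ x ∈ G, ∑ t ∈ Finset.range N,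
        thin ((1 - 1 / K) ^ t) Finset.univ (fun Y => guessError b Y x) := by
  have hm0 : (0 : ℝ) < Fintype.card ι := by exact_mod_cast hm
  set l := Real.log (32 * Fintype.card ι) with hl
  have hrβ : 1 / (32 * (Fintype.card ι : ℝ)) * Fintype.card β = 32 * Fintype.card ι := by
    rw [hβ]; push_cast; field_simp
  -- With this `r`, `α * log (r * |β|) = 9`, while `l ≥ 6` gives `17 / 4 + 3 * α ≤ 35 / 4`.
  have h := futureErrorBound (K := K) (α := 9 / l) (r := 1 / (32 * (Fintype.card ι : ℝ)))
    (err := guessError b) (by positivity) hK rfl (guessError_nonneg b) (by positivity)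
    (by rw [hβ]; positivity) (by
      rw [hrβ, ← hl]
      have e1 : 9 / l * l = 9 := by field_simp
      have e2 : 9 / l ≤ 9 / 6 := by gcongr
      linarith)
    (fun J H hJ hH => le_sum_guessError hb (one_add_inv_pow_le (Finset.card_le_univ J)) hJ hH) N
    (fun _ => 0) (fun _ => le_rfl) Finset.univ G (by intro x _ y _ i hi; simp at hi)
  simp only [futureError, zero_div, sub_zero, Finset.sum_const, Finset.card_range, nsmul_eq_mul,
    neg_zero, Real.exp_zero, one_mul, deficiency, Finset.card_univ] at h
  rw [show (N : ℝ) / 8 = N * (1 / 8) by ring]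
  exact h

end WordBound

/-! ### Choosing a frequent message with small error -/

section Messages

lemma card_le_of_length_le (n : ℕ) (M : Finset (List Bool)) (hM : ∀ l ∈ M, l.length ≤ n) :
    M.card ≤ 2 ^ (n + 1) := by
  have hsub : M ⊆ (Finset.range (n + 1)).biUnion fun k =>
      (Finset.univ : Finset (Fin k → Bool)).image List.ofFn := by
    intro l hl
    simp only [Finset.mem_biUnion, Finset.mem_range, Finset.mem_image, Finset.mem_univ, true_and]
    exact ⟨l.length, Nat.lt_succ_of_le (hM l hl), l.get, List.ofFn_get l⟩
  refine (Finset.card_le_card hsub).trans (Finset.card_biUnion_le.trans ?_)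
  have h1 : ∀ k ∈ Finset.range (n + 1),
      ((Finset.univ : Finset (Fin k → Bool)).image List.ofFn).card ≤ 2 ^ k := fun k _ =>
    Finset.card_image_le.trans (by simp)
  refine (Finset.sum_le_sum h1).trans ?_
  rw [Nat.geomSum_eq le_rfl]
  simp

/-- If the average length of the messages and the average error are small, then some message is
sent for many inputs on which the average error is small. -/
lemma exists_message {X : Type*} [Fintype X] [Nonempty X] (a : X → List Bool) (e : X → ℝ)
    {δ C : ℝ} (hδ : 0 < δ) (hC : 0 < C) (he0 : ∀ x, 0 ≤ e x)
    (he : ∑ x, e x ≤ 2 * δ * Fintype.card X)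
    (hlen : ∑ x, ((a x).length : ℝ) ≤ 2 * C * Fintype.card X) :
    ∃ msg, (Fintype.card X : ℝ) ≤
        2 ^ (⌊8 * C⌋₊ + 3) * (Finset.univ.filter fun x => a x = msg).card ∧
      ∑ x ∈ Finset.univ.filter (fun x => a x = msg), e x ≤
        8 * δ * (Finset.univ.filter fun x => a x = msg).card := by
  have hX : (0 : ℝ) < Fintype.card X := by exact_mod_cast Fintype.card_pos
  set n := ⌊8 * C⌋₊ with hn
  set R := Finset.univ.filter fun x => (a x).length ≤ n with hR
  have hlong : ((Finset.univ.filter fun x => ¬ (a x).length ≤ n).card : ℝ) * (8 * C) ≤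
      2 * C * Fintype.card X := by
    refine le_trans ?_ hlen
    refine le_trans ?_ (Finset.sum_le_sum_of_subset_of_nonneg
      (Finset.filter_subset (fun x => ¬ (a x).length ≤ n) _) fun x _ _ => Nat.cast_nonneg _)
    rw [← nsmul_eq_mul]
    refine Finset.card_nsmul_le_sum _ _ _ fun x hx => ?_
    have := (Finset.mem_filter.1 hx).2
    exact ((Nat.floor_lt (by positivity)).1 (not_le.1 this)).le
  have hcompl : (R.card : ℝ) + (Finset.univ.filter fun x => ¬ (a x).length ≤ n).card =
      Fintype.card X := by
    have := Finset.card_filter_add_card_filter_not (s := (Finset.univ : Finset X))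
      (fun x => (a x).length ≤ n)
    rw [Finset.card_univ] at this
    exact_mod_cast this
  have hRcard : 3 / 4 * (Fintype.card X : ℝ) ≤ R.card := by
    have : ((Finset.univ.filter fun x => ¬ (a x).length ≤ n).card : ℝ) ≤ Fintype.card X / 4 := by
      refine le_of_not_gt fun hlt => ?_
      have := mul_lt_mul_of_pos_right hlt (show 0 < 8 * C by positivity)
      linarith
    linarith
  -- By Markov's inequality at least `3 / 4` of the inputs have short messages. If every message
  -- were rare or bad, the rare ones and the bad ones would cover at most `1 / 4` each.
  by_contra hcon
  push Not at hcon
  set M := R.image a with hM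
  have hMcard : (M.card : ℝ) ≤ 2 ^ (n + 1) := by
    exact_mod_cast card_le_of_length_le n M (by
      intro l hl
      obtain ⟨x, hx, rfl⟩ := Finset.mem_image.1 hl
      exact (Finset.mem_filter.1 hx).2)
  have hfib : ∀ l ∈ M, ((R.filter fun x => a x = l).card : ℝ) ≤
      Fintype.card X / 2 ^ (n + 3) +
        (∑ x ∈ Finset.univ.filter (fun x => a x = l), e x) / (8 * δ) := by
    intro l _
    have h1 : ((R.filter fun x => a x = l).card : ℝ) ≤
        (Finset.univ.filter fun x => a x = l).card := by
      exact_mod_cast Finset.card_le_card (Finset.filter_subset_filter _ (Finset.subset_univ _))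
    refine h1.trans ?_
    have hs : 0 ≤ ∑ x ∈ Finset.univ.filter (fun x => a x = l), e x :=
      Finset.sum_nonneg fun x _ => he0 x
    by_cases hc : (Fintype.card X : ℝ) ≤
        2 ^ (n + 3) * (Finset.univ.filter fun x => a x = l).card
    · have h2 := hcon l hc
      have h3 : ((Finset.univ.filter fun x => a x = l).card : ℝ) ≤
          (∑ x ∈ Finset.univ.filter (fun x => a x = l), e x) / (8 * δ) := by
        rw [le_div_iff₀ (by positivity)]; linarith
      have : 0 ≤ (Fintype.card X : ℝ) / 2 ^ (n + 3) := by positivity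
      linarith
    · push Not at hc
      have h3 : ((Finset.univ.filter fun x => a x = l).card : ℝ) ≤
          Fintype.card X / 2 ^ (n + 3) := by
        rw [le_div_iff₀ (by positivity)]; linarith
      have : 0 ≤ (∑ x ∈ Finset.univ.filter (fun x => a x = l), e x) / (8 * δ) := by positivity
      linarith
  have hsum : (R.card : ℝ) = ∑ l ∈ M, ((R.filter fun x => a x = l).card : ℝ) := by
    exact_mod_cast Finset.card_eq_sum_card_image a R
  have herr : ∑ l ∈ M, ∑ x ∈ Finset.univ.filter (fun x => a x = l), e x ≤ ∑ x, e x := by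
    classical
    rw [← Finset.sum_biUnion (by
      intro l _ l' _ hne
      refine Finset.disjoint_left.2 fun x hx hx' => hne ?_
      rw [← (Finset.mem_filter.1 hx).2, (Finset.mem_filter.1 hx').2])]
    exact Finset.sum_le_sum_of_subset_of_nonneg (Finset.subset_univ _) fun x _ _ => he0 x
  have htot := Finset.sum_le_sum hfib
  rw [← hsum, Finset.sum_add_distrib, Finset.sum_const, nsmul_eq_mul, ← Finset.sum_div] at htot
  have h4 : (∑ l ∈ M, ∑ x ∈ Finset.univ.filter (fun x => a x = l), e x) / (8 * δ) ≤
      Fintype.card X / 4 := by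
    rw [div_le_iff₀ (by positivity)]; linarith
  have h5 : (M.card : ℝ) * (Fintype.card X / 2 ^ (n + 3)) ≤
      2 ^ (n + 1) * (Fintype.card X / 2 ^ (n + 3)) :=
    mul_le_mul_of_nonneg_right hMcard (by positivity)
  have h6 : (2 : ℝ) ^ (n + 1) * (Fintype.card X / 2 ^ (n + 3)) = Fintype.card X / 4 := by
    rw [show n + 3 = (n + 1) + 2 by ring, pow_add 2 (n + 1) 2]; field_simp; norm_num
  linarith

end Messages

/-! ### Fixing the coins -/

section Averaging

/-- The distribution of `f a` when `a` has weight `w a`. -/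
lemma exists_pmf_tsum_eq {A I : Type*} [Fintype A] (w : A → ℝ) (hw : ∀ a, 0 ≤ w a)
    (hsum : ∑ a, w a = 1) (f : A → I) :
    ∃ D : PMF I, ∀ g : I → ℝ≥0∞, ∑' i, D i * g i = ∑ a, ENNReal.ofReal (w a) * g (f a) := by
  classical
  refine ⟨(PMF.ofFintype (fun a => ENNReal.ofReal (w a)) ?_).map f, fun g => ?_⟩
  · rw [← ENNReal.ofReal_sum_of_nonneg fun a _ => hw a, hsum, ENNReal.ofReal_one]
  · simp only [PMF.map_apply, PMF.ofFintype_apply, tsum_fintype, Finset.sum_mul]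
    rw [Summable.tsum_finsetSum fun _ _ => ENNReal.summable]
    refine Finset.sum_congr rfl fun a _ => ?_
    rw [tsum_eq_single (f a)]
    · simp
    · intro i hi; simp [hi]

lemma OneWayProtocol.measurableSet_output {U : ℕ} (P : OneWayProtocol U) (x : URDecInput U)
    (s : Set Bool) : MeasurableSet {ω | P.output ω x ∈ s} := by
  have : {ω | P.output ω x ∈ s} = ⋃ b ∈ s, ⋃ msg : List Bool,
      {ω | P.alice ω x.S = msg} ∩ {ω | P.bob ω msg x.T x.P₁ x.P₂ = b} := by
    ext ω
    simp [OneWayProtocol.output]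
  rw [this]
  exact MeasurableSet.biUnion (Set.to_countable s) fun b _ => MeasurableSet.iUnion fun msg =>
    (P.measurableSet_alice _ _).inter (P.measurableSet_bob _ _ _ _ _)

lemma OneWayProtocol.measurable_length {U : ℕ} (P : OneWayProtocol U) (S : Finset (Fin U)) :
    Measurable fun ω => ((P.alice ω S).length : ℝ≥0∞) := by
  have h : Measurable fun ω => (P.alice ω S).length := by
    refine measurable_to_countable' fun n => ?_
    have : (fun ω => (P.alice ω S).length) ⁻¹' {n} =
        ⋃ msg ∈ {l : List Bool | l.length = n}, {ω | P.alice ω S = msg} := by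
      ext ω; simp
    rw [this]
    exact MeasurableSet.biUnion (Set.to_countable _) fun msg _ => P.measurableSet_alice _ _
  exact (measurable_of_countable (fun n : ℕ => (n : ℝ≥0∞))).comp h

open Classical in
/-- Some outcome of the coins has small error and small cost at the same time. -/
lemma OneWayProtocol.exists_coins {U : ℕ} (P : OneWayProtocol U) {A : Type*} [Fintype A]
    (w : A → ℝ) (hw : ∀ a, 0 ≤ w a) (hsum : ∑ a, w a = 1) (f : A → URDecInput U)
    {δ C : ℝ} (hδ : 0 < δ) (hδ1 : δ < 1) (hC : 0 < C)
    (hsucc : ENNReal.ofReal (1 - δ) ≤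
      ∑ a, ENNReal.ofReal (w a) * P.coins {ω | (f a).IsCorrect (P.output ω (f a))})
    (hcost : ∑ a, ENNReal.ofReal (w a) * ∫⁻ ω, ((P.alice ω (f a).S).length : ℝ≥0∞) ∂P.coins ≤
      ENNReal.ofReal C) :
    ∃ ω, ∑ a, w a * (if (f a).IsCorrect (P.output ω (f a)) then 0 else 1) ≤ 2 * δ ∧
      ∑ a, w a * ((P.alice ω (f a).S).length : ℝ) ≤ 2 * C := by
  -- Error and cost are combined with weights `C` and `δ`, so that each adds at most `C * δ` to the
  -- mean; one outcome not above the mean controls both.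
  set g : P.Ω → ℝ≥0∞ := fun ω => ∑ a, ENNReal.ofReal (w a) *
    (ENNReal.ofReal C * ({ω | ¬ (f a).IsCorrect (P.output ω (f a))}.indicator 1 ω) +
      ENNReal.ofReal δ * ((P.alice ω (f a).S).length : ℝ≥0∞)) with hg
  have hmeas : ∀ a, MeasurableSet {ω | (f a).IsCorrect (P.output ω (f a))} := fun a =>
    P.measurableSet_output (f a) {b | (f a).IsCorrect b}
  have hind : ∀ a, Measurable
      ({ω | ¬ (f a).IsCorrect (P.output ω (f a))}.indicator (1 : P.Ω → ℝ≥0∞)) := fun a =>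
    measurable_one.indicator (hmeas a).compl
  have hm' : ∀ a, Measurable fun ω =>
    ENNReal.ofReal C * ({ω | ¬ (f a).IsCorrect (P.output ω (f a))}.indicator 1 ω) +
      ENNReal.ofReal δ * ((P.alice ω (f a).S).length : ℝ≥0∞) := fun a =>
    ((hind a).const_mul _).add ((P.measurable_length _).const_mul _)
  have hm : ∀ a, Measurable fun ω => ENNReal.ofReal (w a) *
    (ENNReal.ofReal C * ({ω | ¬ (f a).IsCorrect (P.output ω (f a))}.indicator 1 ω) +
      ENNReal.ofReal δ * ((P.alice ω (f a).S).length : ℝ≥0∞)) := fun a =>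
    (hm' a).const_mul _
  have hint : ∫⁻ ω, g ω ∂P.coins = ENNReal.ofReal C *
      (∑ a, ENNReal.ofReal (w a) * P.coins {ω | ¬ (f a).IsCorrect (P.output ω (f a))}) +
      ENNReal.ofReal δ *
        ∑ a, ENNReal.ofReal (w a) * ∫⁻ ω, ((P.alice ω (f a).S).length : ℝ≥0∞) ∂P.coins := by
    simp only [hg]
    rw [lintegral_finsetSum _ fun a _ => hm a, Finset.mul_sum, Finset.mul_sum,
      ← Finset.sum_add_distrib]
    refine Finset.sum_congr rfl fun a _ => ?_
    rw [lintegral_const_mul _ (hm' a),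
      lintegral_add_left ((hind a).const_mul _), lintegral_const_mul _ (hind a),
      lintegral_const_mul _ (P.measurable_length _), lintegral_indicator_one
        (s := {ω | ¬ (f a).IsCorrect (P.output ω (f a))}) (hmeas a).compl]
    ring
  have hfail : ∑ a, ENNReal.ofReal (w a) * P.coins {ω | ¬ (f a).IsCorrect (P.output ω (f a))} ≤
      ENNReal.ofReal δ := by
    have h1 : ∑ a, ENNReal.ofReal (w a) * P.coins {ω | ¬ (f a).IsCorrect (P.output ω (f a))} +
        ∑ a, ENNReal.ofReal (w a) * P.coins {ω | (f a).IsCorrect (P.output ω (f a))} = 1 := by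
      rw [← Finset.sum_add_distrib]
      have : ∀ a, ENNReal.ofReal (w a) * P.coins {ω | ¬ (f a).IsCorrect (P.output ω (f a))} +
          ENNReal.ofReal (w a) * P.coins {ω | (f a).IsCorrect (P.output ω (f a))} =
          ENNReal.ofReal (w a) := fun a => by
        rw [← mul_add, add_comm]
        have := measure_add_measure_compl (μ := P.coins) (hmeas a)
        rw [measure_univ] at this
        rw [Set.compl_ofPred] at this
        rw [this, mul_one]
      simp_rw [this]
      rw [← ENNReal.ofReal_sum_of_nonneg fun a _ => hw a, hsum, ENNReal.ofReal_one]
    have h2 : ∑ a, ENNReal.ofReal (w a) * P.coins {ω | ¬ (f a).IsCorrect (P.output ω (f a))} +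
        ENNReal.ofReal (1 - δ) ≤ ENNReal.ofReal δ + ENNReal.ofReal (1 - δ) := by
      rw [← ENNReal.ofReal_add hδ.le (by linarith), add_sub_cancel, ENNReal.ofReal_one, ← h1]
      gcongr
    exact (ENNReal.add_le_add_iff_right ENNReal.ofReal_ne_top).1 h2
  obtain ⟨ω, hω⟩ := exists_le_lintegral (μ := P.coins) (f := g)
    (Finset.measurable_fun_sum _ fun a _ => hm a).aemeasurable
  refine ⟨ω, ?_⟩
  have hle : g ω ≤ ENNReal.ofReal (2 * (C * δ)) := by
    refine hω.trans ?_
    rw [hint]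
    refine (add_le_add (mul_le_mul_right hfail _) (mul_le_mul_right hcost _)).trans ?_
    rw [← ENNReal.ofReal_mul hC.le, ← ENNReal.ofReal_mul hδ.le,
      ← ENNReal.ofReal_add (by positivity) (by positivity)]
    exact ENNReal.ofReal_le_ofReal (by linarith)
  have hgω : g ω = ENNReal.ofReal (∑ a, w a *
      (C * (if (f a).IsCorrect (P.output ω (f a)) then 0 else 1) +
        δ * ((P.alice ω (f a).S).length : ℝ))) := by
    rw [ENNReal.ofReal_sum_of_nonneg fun a _ => mul_nonneg (hw a) (by positivity)]
    refine Finset.sum_congr rfl fun a _ => ?_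
    rw [ENNReal.ofReal_mul (hw a), ENNReal.ofReal_add (by positivity) (by positivity),
      ENNReal.ofReal_mul hC.le, ENNReal.ofReal_mul hδ.le, ENNReal.ofReal_natCast]
    congr 3
    by_cases h : (f a).IsCorrect (P.output ω (f a)) <;> simp [h]
  rw [hgω, ENNReal.ofReal_le_ofReal_iff (by positivity)] at hle
  simp_rw [mul_add] at hle
  rw [Finset.sum_add_distrib] at hle
  have e1 : ∑ a, w a * (C * (if (f a).IsCorrect (P.output ω (f a)) then (0 : ℝ) else 1)) =
      C * ∑ a, w a * (if (f a).IsCorrect (P.output ω (f a)) then 0 else 1) := by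
    rw [Finset.mul_sum]; exact Finset.sum_congr rfl fun a _ => by ring
  have e2 : ∑ a, w a * (δ * ((P.alice ω (f a).S).length : ℝ)) =
      δ * ∑ a, w a * ((P.alice ω (f a).S).length : ℝ) := by
    rw [Finset.mul_sum]; exact Finset.sum_congr rfl fun a _ => by ring
  rw [e1, e2] at hle
  have n1 : 0 ≤ ∑ a, w a * (if (f a).IsCorrect (P.output ω (f a)) then (0 : ℝ) else 1) :=
    Finset.sum_nonneg fun a _ => mul_nonneg (hw a) (by positivity)
  have n2 : 0 ≤ ∑ a, w a * ((P.alice ω (f a).S).length : ℝ) :=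
    Finset.sum_nonneg fun a _ => mul_nonneg (hw a) (by positivity)
  constructor
  · refine le_of_mul_le_mul_left ?_ hC
    have := mul_nonneg hδ.le n2
    linarith
  · refine le_of_mul_le_mul_left ?_ hδ
    have := mul_nonneg hC.le n1
    linarith

end Averaging

/-! ### The hard inputs -/

section HardInput

variable {ι β : Type*} [DecidableEq ι] [DecidableEq β] [Fintype ι] {U : ℕ}

/-- Bob's set: the graph of `x` outside `J`. -/
def hardT (e : ι × β ↪ Fin U) (J : Finset ι) (x : ι → β) : Finset (Fin U) :=
  (graphOn Jᶜ x).map e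

/-- Bob's second part: the points of colour `false` outside his set. -/
def hardPart [Fintype β] (e : ι × β ↪ Fin U) (J : Finset ι) (x : ι → β) (P : ι × β → Bool) :
    Finset (Fin U) :=
  ((Finset.univ.filter fun p => P p = false).map e) \ hardT e J x

lemma graphOn_univ_map_sdiff_hardT (e : ι × β ↪ Fin U) (J : Finset ι) (x : ι → β) :
    (graphOn Finset.univ x).map e \ hardT e J x = (graphOn J x).map e := by
  ext u
  simp only [hardT, Finset.mem_sdiff, Finset.mem_map, mem_graphOn, Finset.mem_univ, true_and,
    Finset.mem_compl]
  constructor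
  · rintro ⟨⟨p, hp, rfl⟩, h⟩
    refine ⟨p, ⟨?_, hp⟩, rfl⟩
    by_contra hJ
    exact h ⟨p, ⟨hJ, hp⟩, rfl⟩
  · rintro ⟨p, ⟨hJ, hp⟩, rfl⟩
    refine ⟨⟨p, hp, rfl⟩, ?_⟩
    rintro ⟨p', ⟨hJ', -⟩, h⟩
    rw [e.injective h] at hJ'
    exact hJ' hJ

lemma graphOn_map_subset [Fintype β] (e : ι × β ↪ Fin U) (J : Finset ι) (x : ι → β) (σ : Bool)
    (P : ι × β → Bool) :
    (graphOn J x).map e ⊆ if σ then (hardT e J x)ᶜ \ hardPart e J x (recolour P (graphOn J x) σ)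
      else hardPart e J x (recolour P (graphOn J x) σ) := by
  intro u hu
  have hnT : u ∉ hardT e J x := by
    rw [← graphOn_univ_map_sdiff_hardT] at hu
    exact (Finset.mem_sdiff.1 hu).2
  obtain ⟨p, hp, rfl⟩ := Finset.mem_map.1 hu
  have hc : recolour P (graphOn J x) σ p = σ := by simp [recolour, hp]
  cases σ
  · simp only [Bool.false_eq_true, if_false, hardPart, Finset.mem_sdiff, Finset.mem_map,
      Finset.mem_filter, Finset.mem_univ, true_and]
    exact ⟨⟨p, hc, rfl⟩, hnT⟩
  · simp only [if_true, Finset.mem_sdiff, Finset.mem_compl]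
    refine ⟨hnT, fun h => ?_⟩
    simp only [hardPart, Finset.mem_sdiff, Finset.mem_map, Finset.mem_filter, Finset.mem_univ,
      true_and] at h
    obtain ⟨⟨p', hp', h'⟩, -⟩ := h
    rw [e.injective h', hc] at hp'
    exact Bool.noConfusion hp'

/-- The input in which Alice holds the graph of `x`, Bob knows it outside `J`, and the parts are
given by a colouring with colour `σ` on the graph over `J`. -/
def hardInput [Fintype β] (e : ι × β ↪ Fin U) (J : Finset ι) (hJ : J.Nonempty) (x : ι → β) (σ : Bool)
    (P : ι × β → Bool) : URDecInput U where
  S := (graphOn Finset.univ x).map e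
  T := hardT e J x
  P₁ := (hardT e J x)ᶜ \ hardPart e J x (recolour P (graphOn J x) σ)
  P₂ := hardPart e J x (recolour P (graphOn J x) σ)
  T_ssubset_S := by
    rw [Finset.ssubset_iff_subset_ne]
    constructor
    · refine Finset.map_subset_map.2 fun p hp => ?_
      rw [mem_graphOn] at hp ⊢
      exact ⟨Finset.mem_univ _, hp.2⟩
    · intro h
      have h2 := graphOn_univ_map_sdiff_hardT e J x
      rw [← h, Finset.sdiff_self] at h2
      have h3 := congrArg Finset.card h2
      rw [Finset.card_empty, Finset.card_map, card_graphOn] at h3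
      exact hJ.card_pos.ne h3
  parts_disjoint := Finset.sdiff_disjoint
  parts_union := by
    refine Finset.sdiff_union_of_subset fun u hu => ?_
    rw [Finset.mem_compl]
    exact (Finset.mem_sdiff.1 hu).2
  promise := by
    rw [graphOn_univ_map_sdiff_hardT]
    have := graphOn_map_subset e J x σ P
    cases σ
    · exact Or.inr (by simpa using this)
    · exact Or.inl (by simpa using this)

lemma hardInput_isCorrect_iff [Fintype β] (e : ι × β ↪ Fin U) (J : Finset ι) (hJ : J.Nonempty) (x : ι → β)
    (σ : Bool) (P : ι × β → Bool) (a : Bool) :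
    (hardInput e J hJ x σ P).IsCorrect a ↔ a = σ := by
  have hsub := graphOn_map_subset e J x σ P
  unfold URDecInput.IsCorrect
  simp only [hardInput]
  rw [graphOn_univ_map_sdiff_hardT]
  constructor
  · intro h
    obtain ⟨i, hi⟩ := hJ
    have hu : e (i, x i) ∈ (graphOn J x).map e :=
      Finset.mem_map_of_mem e (mem_graphOn.2 ⟨hi, rfl⟩)
    have h1 := h hu
    have h2 := hsub hu
    cases a <;> cases σ <;> simp_all
  · rintro rfl
    exact hsub

/-- The set itself, or everything if the set is empty. -/
def nonemptyOr (Y : Finset ι) : Finset ι := if Y = ∅ then Finset.univ else Y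

lemma nonemptyOr_nonempty [Nonempty ι] (Y : Finset ι) : (nonemptyOr Y).Nonempty := by
  unfold nonemptyOr
  split_ifs with h
  · exact Finset.univ_nonempty
  · exact Finset.nonempty_iff_ne_empty.2 h

end HardInput

/-! ### The hard distribution and the reduction to a single guessing rule -/

section HardDistribution

variable {ι β : Type*} [DecidableEq ι] [DecidableEq β] [Fintype ι] [Fintype β]

/-- The weight of the word `x`, the scale `t`, the set `Y`, the colour `σ` and the colouring `P`. -/
noncomputable def hardWeight (q : ℕ → ℝ) (N : ℕ)
    (a : (ι → β) × Fin N × Finset ι × Bool × (ι × β → Bool)) : ℝ :=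
  1 / Fintype.card (ι → β) * (1 / N * (q a.2.1 ^ a.2.2.1.card *
    (1 - q a.2.1) ^ (Fintype.card ι - a.2.2.1.card) * (1 / 2 * (1 / 2 ^ Fintype.card (ι × β)))))

lemma sum_hardWeight_mul (q : ℕ → ℝ) (N : ℕ)
    (F : (ι → β) × Fin N × Finset ι × Bool × (ι × β → Bool) → ℝ) :
    ∑ a, hardWeight q N a * F a = 1 / Fintype.card (ι → β) * ∑ x, 1 / N * ∑ t : Fin N,
      thin (q t) Finset.univ fun Y => 1 / 2 * (1 / 2 ^ Fintype.card (ι × β)) *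
        ∑ σ : Bool, ∑ P, F (x, t, Y, σ, P) := by
  simp only [Fintype.sum_prod_type, hardWeight, thin, Finset.mul_sum, Finset.powerset_univ,
    Finset.card_univ]
  refine Finset.sum_congr rfl fun x _ => Finset.sum_congr rfl fun t _ =>
    Finset.sum_congr rfl fun Y _ => Finset.sum_congr rfl fun σ _ =>
    Finset.sum_congr rfl fun P _ => ?_
  ring

lemma sum_hardWeight_mul_fst [Nonempty β] (q : ℕ → ℝ) {N : ℕ} (hN : 0 < N) (f : (ι → β) → ℝ) :
    ∑ a, hardWeight q N a * f a.1 = 1 / Fintype.card (ι → β) * ∑ x, f x := by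
  rw [sum_hardWeight_mul]
  congr 1
  refine Finset.sum_congr rfl fun x _ => ?_
  have hN' : (N : ℝ) ≠ 0 := by exact_mod_cast hN.ne'
  simp only [Finset.sum_const, thin_const, Finset.card_univ, Fintype.card_fun, Fintype.card_bool,
    Fintype.card_fin, nsmul_eq_mul]
  push_cast
  field_simp

/-- Fixing coins and message makes Bob a deterministic rule `b`, and `G` is the set of words sent to
that message. `T` and the parts depend on `x` only off `J` once the colouring is given, hence the
first property of `b`. The last sum is the probability of an empty `Y`. -/
lemma exists_hard_distribution [Nonempty ι] [Nonempty β] {U : ℕ} (e : ι × β ↪ Fin U) {ρ : ℝ}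
    (hρ0 : 0 ≤ ρ) (hρ1 : ρ ≤ 1) {N : ℕ} (hN : 0 < N) :
    ∃ D : PMF (URDecInput U), ∀ (P : OneWayProtocol U) (δ C : ℝ), 0 < δ → δ < 1 → 0 < C →
      ENNReal.ofReal (1 - δ) ≤ P.successProb D → P.expectedCost D ≤ ENNReal.ofReal C →
      ∃ (b : Finset ι → (ι → β) → (ι × β → Bool) → Bool) (G : Finset (ι → β)),
        (∀ J x y, (∀ i, i ∉ J → x i = y i) → b J x = b J y) ∧
        (Fintype.card (ι → β) : ℝ) ≤ 2 ^ (⌊8 * C⌋₊ + 3) * G.card ∧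
        ∑ x ∈ G, ∑ t ∈ Finset.range N, thin (ρ ^ t) Finset.univ (fun Y => guessError b Y x) ≤
          G.card * (8 * δ * N + ∑ t ∈ Finset.range N, (1 - ρ ^ t) ^ Fintype.card ι) := by
  have hq0 : ∀ t : ℕ, 0 ≤ ρ ^ t := fun t => by positivity
  have hq1 : ∀ t : ℕ, ρ ^ t ≤ 1 := fun t => pow_le_one₀ hρ0 hρ1
  have hN0 : (0 : ℝ) < N := by exact_mod_cast hN
  have hX0 : (0 : ℝ) < Fintype.card (ι → β) := by exact_mod_cast Fintype.card_pos
  set w := hardWeight (ι := ι) (β := β) (fun t => ρ ^ t) N with hw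
  have hw0 : ∀ a, 0 ≤ w a := fun a => by
    have h1 : 0 ≤ 1 - ρ ^ (a.2.1 : ℕ) := by linarith [hq1 a.2.1]
    have h2 := hq0 a.2.1
    rw [hw]; unfold hardWeight
    positivity
  have hw1 : ∑ a, w a = 1 := by
    have := sum_hardWeight_mul_fst (ι := ι) (β := β) (fun t => ρ ^ t) hN (fun _ => 1)
    simp only [mul_one, Finset.sum_const, Finset.card_univ, nsmul_eq_mul] at this
    rw [hw, this]
    field_simp
  -- An empty `Y` would give `T = S`, which is not a legal input; the full set stands in for it.
  set inp : (ι → β) × Fin N × Finset ι × Bool × (ι × β → Bool) → URDecInput U := fun a =>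
    hardInput e (nonemptyOr a.2.2.1) (nonemptyOr_nonempty _) a.1 a.2.2.2.1 a.2.2.2.2 with hinp
  obtain ⟨D, hD⟩ := exists_pmf_tsum_eq w hw0 hw1 inp
  refine ⟨D, fun P δ C hδ hδ1 hC hsucc hcost => ?_⟩
  unfold OneWayProtocol.successProb at hsucc
  unfold OneWayProtocol.expectedCost at hcost
  rw [hD] at hsucc hcost
  obtain ⟨ω, herr, hlen⟩ := P.exists_coins w hw0 hw1 inp hδ hδ1 hC hsucc hcost
  set al : (ι → β) → List Bool := fun x => P.alice ω ((graphOn Finset.univ x).map e) with hal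
  set bob : List Bool → Finset ι → (ι → β) → (ι × β → Bool) → Bool := fun msg J x c =>
    P.bob ω msg (hardT e J x) ((hardT e J x)ᶜ \ hardPart e J x c) (hardPart e J x c) with hbob
  set ge : List Bool → Finset ι → (ι → β) → ℝ := fun msg J x =>
    1 / 2 * (1 / 2 ^ Fintype.card (ι × β)) * ∑ σ : Bool, ∑ c : ι × β → Bool,
      if bob msg J x (recolour c (graphOn J x) σ) ≠ σ then 1 else 0 with hge
  have hge0 : ∀ msg J x, 0 ≤ ge msg J x := fun msg J x =>
    mul_nonneg (by positivity) (Finset.sum_nonneg fun σ _ => Finset.sum_nonneg fun c _ => by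
      split_ifs <;> norm_num)
  set err : (ι → β) → ℝ := fun x => 1 / N * ∑ t : Fin N,
    thin (ρ ^ (t : ℕ)) Finset.univ (fun Y => ge (al x) (nonemptyOr Y) x) with herrdef
  have herr0 : ∀ x, 0 ≤ err x := fun x => mul_nonneg (by positivity)
    (Finset.sum_nonneg fun t _ => thin_nonneg (hq0 t) (hq1 t) fun Y => hge0 _ _ _)
  have herr' : ∑ x, err x ≤ 2 * δ * Fintype.card (ι → β) := by
    rw [hw, sum_hardWeight_mul] at herr
    have e1 : ∀ (x : ι → β) (t : Fin N) (Y : Finset ι) (σ : Bool) (c : ι × β → Bool),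
        (open Classical in if (inp (x, t, Y, σ, c)).IsCorrect (P.output ω (inp (x, t, Y, σ, c)))
          then (0 : ℝ) else 1) =
        if bob (al x) (nonemptyOr Y) x (recolour c (graphOn (nonemptyOr Y) x) σ) ≠ σ
          then 1 else 0 := by
      intro x t Y σ c
      have h := hardInput_isCorrect_iff e (nonemptyOr Y) (nonemptyOr_nonempty _) x σ c
        (P.output ω (inp (x, t, Y, σ, c)))
      have h2 : P.output ω (inp (x, t, Y, σ, c)) =
        bob (al x) (nonemptyOr Y) x (recolour c (graphOn (nonemptyOr Y) x) σ) := rfl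
      rw [h2] at h
      rw [h2]
      simp only [hinp, h, ne_eq, ite_not]
    simp_rw [e1] at herr
    rw [one_div_mul_eq_div, div_le_iff₀ hX0] at herr
    exact herr
  have hlen' : ∑ x, ((al x).length : ℝ) ≤ 2 * C * Fintype.card (ι → β) := by
    have e2 : ∀ a, ((P.alice ω (inp a).S).length : ℝ) = (al a.1).length := fun a => rfl
    simp_rw [e2] at hlen
    rw [hw, sum_hardWeight_mul_fst _ hN (fun x => ((al x).length : ℝ)), one_div_mul_eq_div,
      div_le_iff₀ hX0] at hlen
    exact hlen
  obtain ⟨msg, hcard, hmsg⟩ := exists_message al err hδ hC herr0 herr' hlen'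
  refine ⟨bob msg, Finset.univ.filter fun x => al x = msg, ?_, hcard, ?_⟩
  · intro J x y hxy
    have : graphOn Jᶜ x = graphOn Jᶜ y := by
      refine Finset.image_congr fun i hi => ?_
      have hi' : i ∉ J := by simpa using hi
      rw [hxy i hi']
    have hT : hardT e J x = hardT e J y := by unfold hardT; rw [this]
    funext c
    simp only [hbob, hardPart, hT]
  · have hpt : ∀ x ∈ Finset.univ.filter (fun x => al x = msg), ∑ t ∈ Finset.range N,
        thin (ρ ^ t) Finset.univ (fun Y => guessError (bob msg) Y x) ≤
        N * err x + ∑ t ∈ Finset.range N, (1 - ρ ^ t) ^ Fintype.card ι := by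
      intro x hx
      have hx' : al x = msg := (Finset.mem_filter.1 hx).2
      have e3 : N * err x = ∑ t ∈ Finset.range N,
          thin (ρ ^ t) Finset.univ (fun Y => ge msg (nonemptyOr Y) x) := by
        simp only [herrdef, hx']
        rw [← Finset.sum_range fun t =>
          thin (ρ ^ t) Finset.univ (fun Y => ge msg (nonemptyOr Y) x)]
        field_simp
      rw [e3, ← Finset.sum_add_distrib]
      refine Finset.sum_le_sum fun t _ => ?_
      rw [← Finset.card_univ, ← thin_empty_indicator]
      have e4 : ∀ (q : ℝ) (J : Finset ι) (f g : Finset ι → ℝ),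
          thin q J f + thin q J g = thin q J (fun Y => f Y + g Y) := by
        intro q J f g
        unfold thin
        rw [← Finset.sum_add_distrib]
        exact Finset.sum_congr rfl fun Y _ => by ring
      rw [e4]
      refine thin_mono (hq0 t) (hq1 t) fun Y _ => ?_
      -- The two errors differ only at `Y = ∅`, where `guessError` is `1` by convention.
      by_cases hY : Y = ∅
      · have := hge0 msg (nonemptyOr Y) x
        simp only [guessError, if_pos hY]
        linarith
      · simp only [guessError, nonemptyOr, if_neg hY, hge, add_zero]
        exact le_rfl
    refine (Finset.sum_le_sum hpt).trans ?_
    rw [Finset.sum_add_distrib, ← Finset.mul_sum, Finset.sum_const, nsmul_eq_mul]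
    have := mul_le_mul_of_nonneg_left hmsg hN0.le
    linarith

end HardDistribution

/-! ### Choice of the parameters -/

section Parameters

lemma le_one_sub_inv_pow {K : ℕ} (hK : 2 ≤ K) (L : ℕ) :
    Real.exp (-(2 * L)) ≤ (1 - 1 / (K : ℝ)) ^ (K * L) := by
  have hK2 : (2 : ℝ) ≤ K := by exact_mod_cast hK
  have hρ : 0 < 1 - 1 / (K : ℝ) := by
    rw [sub_pos, div_lt_one (by linarith)]; linarith
  rw [← Real.exp_log (pow_pos hρ (K * L)), Real.log_pow, Real.exp_le_exp]
  have h1 := Real.one_sub_inv_le_log_of_pos hρ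
  have h2 : 1 - (1 - 1 / (K : ℝ))⁻¹ = -(1 / (K - 1)) := by
    have : (K : ℝ) - 1 ≠ 0 := by linarith
    have : (K : ℝ) ≠ 0 := by linarith
    field_simp
    ring
  rw [h2] at h1
  have h3 : (K : ℝ) * (1 / (K - 1)) ≤ 2 := by
    rw [mul_one_div, div_le_iff₀ (by linarith)]; linarith
  have hL : (0 : ℝ) ≤ L := Nat.cast_nonneg L
  have h4 := mul_le_mul_of_nonneg_left h1 (show 0 ≤ ((K * L : ℕ) : ℝ) by positivity)
  have h5 := mul_le_mul_of_nonneg_right h3 hL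
  push_cast at h4 ⊢
  linarith

lemma one_sub_pow_pow_le {ρ : ℝ} (hρ0 : 0 ≤ ρ) (hρ1 : ρ ≤ 1) {t N : ℕ} (h : t ≤ N) (m : ℕ) :
    (1 - ρ ^ t) ^ m ≤ Real.exp (-(m * ρ ^ N)) := by
  have h1 : ρ ^ N ≤ ρ ^ t := pow_le_pow_of_le_one hρ0 hρ1 h
  have h2 : 1 - ρ ^ t ≤ Real.exp (-ρ ^ N) := by linarith [Real.add_one_le_exp (-ρ ^ N)]
  have h3 : 0 ≤ 1 - ρ ^ t := by linarith [pow_le_one₀ (n := t) hρ0 hρ1]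
  refine (pow_le_pow_left₀ h3 h2 m).trans (le_of_eq ?_)
  rw [← Real.exp_nat_mul]
  congr 1; ring

/-- The number of coordinates used over a universe of size `exp u`. -/
lemma exists_wordLength {U : ℕ} (hU : 1000 ≤ Real.log U) :
    ∃ m : ℕ, Real.exp (Real.log U / 3) / 12 ≤ m ∧ m * (32 * m) ^ 2 ≤ U := by
  have hU0 : (0 : ℝ) < U := by
    rcases Nat.eq_zero_or_pos U with rfl | h
    · norm_num at hU
    · exact_mod_cast h
  set y := Real.exp (Real.log U / 3) with hy
  have hy3 : y ^ 3 = U := by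
    rw [hy, ← Real.exp_nat_mul]
    push_cast
    rw [mul_div_cancel₀ _ (by norm_num), Real.exp_log hU0]
  have hy1 : 334 ≤ y := by
    have := Real.add_one_le_exp (Real.log U / 3)
    linarith
  -- `11 ^ 3 = 1331` exceeds `32 ^ 2 = 1024`, and rounding down still leaves `y / 12`.
  refine ⟨⌊y / 11⌋₊, ?_, ?_⟩
  · have := Nat.sub_one_lt_floor (y / 11)
    linarith
  · have h := Nat.floor_le (show 0 ≤ y / 11 by positivity)
    set m := ⌊y / 11⌋₊
    have h3 := pow_le_pow_left₀ (Nat.cast_nonneg m) h 3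
    have : (m : ℝ) * (32 * m) ^ 2 ≤ U := by
      rw [← hy3]
      have : (m : ℝ) * (32 * m) ^ 2 = 1024 * m ^ 3 := by ring
      have h4 : 0 ≤ y ^ 3 := by positivity
      have h5 : (y / 11) ^ 3 = y ^ 3 / 1331 := by ring
      linarith
    exact_mod_cast this

lemma ten_le_log_one_div {δ : ℝ} (hδ0 : 0 < δ) (hδ : δ < 1 / 10 ^ 12) :
    10 ≤ Real.log (1 / δ) := by
  rw [Real.le_log_iff_exp_le (by positivity), le_one_div (Real.exp_pos _) hδ0]
  have h2 : Real.exp 10 ≤ 3 ^ 10 := by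
    have : Real.exp 10 = Real.exp 1 ^ 10 := by rw [← Real.exp_nat_mul]; norm_num
    rw [this]
    exact pow_le_pow_left₀ (Real.exp_pos _).le (by linarith [Real.exp_one_lt_d9]) 10
  have h3 := one_div_le_one_div_of_le (Real.exp_pos 10) h2
  have h4 : (1 : ℝ) / 10 ^ 12 ≤ 1 / 3 ^ 10 := by norm_num
  linarith

/-- The parameters of the hard distribution: `m` coordinates and `N` scales with ratio
`1 - 1 / K`. -/
lemma exists_scales {U : ℕ} (hu : 1000 ≤ Real.log U) {v : ℝ} (hv10 : 10 ≤ v)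
    (hvU : v ≤ Real.exp (Real.log U / 4)) :
    ∃ m K N : ℕ, Real.exp (Real.log U / 3) / 12 ≤ m ∧ m * (32 * m) ^ 2 ≤ U ∧ 2 ≤ K ∧
      (K : ℝ) ≤ v / 2 ∧ v * Real.log U / 384 ≤ N ∧ v ≤ m * (1 - 1 / (K : ℝ)) ^ N := by
  obtain ⟨m, hm, hmU⟩ := exists_wordLength hu
  set u := Real.log (U : ℝ) with hudef
  have hm0 : (0 : ℝ) < m := lt_of_lt_of_le (by positivity) hm
  have hKle : (⌊v / 2⌋₊ : ℝ) ≤ v / 2 := Nat.floor_le (by linarith)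
  have hKge : v / 4 ≤ ⌊v / 2⌋₊ := by linarith [Nat.sub_one_lt_floor (v / 2)]
  have hK2 : 2 ≤ ⌊v / 2⌋₊ := Nat.le_floor (by norm_num; linarith)
  have hLle : (⌊u / 48⌋₊ : ℝ) ≤ u / 48 := Nat.floor_le (by linarith)
  have hLge : u / 96 ≤ ⌊u / 48⌋₊ := by linarith [Nat.sub_one_lt_floor (u / 48)]
  -- `K ≤ v / 2` makes `exp (-K) ≥ √δ`. The number of scales keeps `ρ ^ N ≥ U ^ (-1/24)`, so about
  -- `U ^ (7/24)` coordinates or more remain on average, more than `v ≤ U ^ (1/4)`.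
  refine ⟨m, ⌊v / 2⌋₊, ⌊v / 2⌋₊ * ⌊u / 48⌋₊, hm, hmU, hK2, hKle, ?_, ?_⟩
  · push_cast
    have := mul_le_mul hKge hLge (by linarith) (by linarith)
    linarith
  · have h1 : Real.exp (-(u / 24)) ≤ (1 - 1 / (⌊v / 2⌋₊ : ℝ)) ^ (⌊v / 2⌋₊ * ⌊u / 48⌋₊) :=
      (Real.exp_le_exp.2 (by linarith)).trans (le_one_sub_inv_pow hK2 _)
    have h2 := mul_le_mul hm h1 (Real.exp_pos _).le hm0.le
    have h3 : Real.exp (u / 3) * Real.exp (-(u / 24)) = Real.exp (u / 24) * Real.exp (u / 4) := by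
      rw [← Real.exp_add, ← Real.exp_add]; congr 1; ring
    have h4 : 12 ≤ Real.exp (u / 24) := by linarith [Real.add_one_le_exp (u / 24)]
    have h5 := mul_le_mul_of_nonneg_right h4 (Real.exp_pos (u / 4)).le
    linarith

/-- Few errors of a guess on a set of words force the set to be small. -/
lemma large_of_sum_guessError_le {m K N : ℕ} {δ v C : ℝ}
    {b : Finset (Fin m) → (Fin m → Fin ((32 * m) ^ 2)) → (Fin m × Fin ((32 * m) ^ 2) → Bool) → Bool}
    (hb : ∀ J x y, (∀ i, i ∉ J → x i = y i) → b J x = b J y)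
    {G : Finset (Fin m → Fin ((32 * m) ^ 2))} (hm : 0 < m) (hlog : 6 ≤ Real.log (32 * m))
    (hK : 2 ≤ K) (hKv : (K : ℝ) ≤ v / 2) (hN : 0 < N) (hvδ : Real.exp (-v) = δ)
    (hδ : δ < 1 / 10 ^ 12) (hvm : v ≤ m * (1 - 1 / (K : ℝ)) ^ N) (hC : 0 ≤ C)
    (hcard : (Fintype.card (Fin m → Fin ((32 * m) ^ 2)) : ℝ) ≤ 2 ^ (⌊8 * C⌋₊ + 3) * G.card)
    (hupper : ∑ x ∈ G, ∑ t ∈ Finset.range N,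
        thin ((1 - 1 / (K : ℝ)) ^ t) Finset.univ (fun Y => guessError b Y x) ≤
      G.card * (8 * δ * N + ∑ t ∈ Finset.range N,
        (1 - (1 - 1 / (K : ℝ)) ^ t) ^ Fintype.card (Fin m))) :
    (N : ℝ) / 16 * Real.log (32 * m) < 9 * (8 * C + 3) := by
  have hBpos : 0 < (32 * m) ^ 2 := by positivity
  have : Nonempty (Fin ((32 * m) ^ 2)) := ⟨⟨0, hBpos⟩⟩
  have hN0 : (0 : ℝ) < N := by exact_mod_cast hN
  have hK2' : (2 : ℝ) ≤ K := by exact_mod_cast hK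
  set ρ : ℝ := 1 - 1 / K with hρ
  have hρ0 : 0 ≤ ρ := by rw [hρ, sub_nonneg, div_le_one (by linarith)]; linarith
  have hρ1 : ρ ≤ 1 := by rw [hρ]; linarith [show 0 ≤ 1 / (K : ℝ) by positivity]
  by_contra hlarge
  push Not at hlarge
  have hlower := le_sum_thin_guessError hb (by simpa using hm) (by simp)
    (by simp only [Fintype.card_fin]; linarith) hK2' N G
  rw [Fintype.card_fin] at hupper
  rw [Fintype.card_fin, Fintype.card_fin] at hlower
  have hG0 : (0 : ℝ) < G.card := by
    have h1 : (0 : ℝ) < Fintype.card (Fin m → Fin ((32 * m) ^ 2)) := by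
      exact_mod_cast Fintype.card_pos
    exact pos_of_mul_pos_right (h1.trans_le hcard) (by positivity)
  have hdef : m * Real.log ((32 * m) ^ 2 : ℕ) - Real.log G.card ≤ 8 * C + 3 := by
    have h1 := Real.log_le_log (by exact_mod_cast Fintype.card_pos) hcard
    rw [Real.log_mul (by positivity) hG0.ne', Real.log_pow, Fintype.card_fun, Fintype.card_fin,
      Fintype.card_fin, Nat.cast_pow, Real.log_pow] at h1
    have h2 : Real.log 2 ≤ 1 := by linarith [Real.log_two_lt_d9]
    have h3 := mul_le_mul_of_nonneg_left h2 (Nat.cast_nonneg (α := ℝ) (⌊8 * C⌋₊ + 3))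
    have h4 := Nat.floor_le (show 0 ≤ 8 * C by positivity)
    rw [Nat.cast_add, Nat.cast_ofNat] at h1 h3
    linarith
  have hmain : 9 / Real.log (32 * m) * (m * Real.log ((32 * m) ^ 2 : ℕ) - Real.log G.card) ≤
      N / 16 := by
    rw [div_mul_eq_mul_div, div_le_iff₀ (by linarith)]
    linarith
  have htail : ∑ t ∈ Finset.range N, (1 - ρ ^ t) ^ m ≤ N * δ := by
    have h1 : ∀ t ∈ Finset.range N, (1 - ρ ^ t) ^ m ≤ δ := by
      intro t ht
      refine (one_sub_pow_pow_le hρ0 hρ1 (Finset.mem_range.1 ht).le m).trans ?_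
      rw [← hvδ]
      exact Real.exp_le_exp.2 (by linarith)
    refine (Finset.sum_le_sum h1).trans (le_of_eq ?_)
    rw [Finset.sum_const, Finset.card_range, nsmul_eq_mul]
  -- Half of `N / 8` survives the deficiency term. The bound then forces `√δ ≥ 1 / 144`,
  -- contradicting `δ < 10 ^ (-12)`.
  have hfin : Real.exp (-(K : ℝ)) * (N / 16) ≤ 9 * δ * N := by
    have h1 : Real.exp (-(K : ℝ)) * G.card * (N / 16) ≤ G.card * (9 * δ * N) := by
      refine le_trans ?_ (hlower.trans (hupper.trans ?_))
      · exact mul_le_mul_of_nonneg_left (by linarith) (by positivity)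
      · exact mul_le_mul_of_nonneg_left (by linarith) hG0.le
    refine le_of_mul_le_mul_left ?_ hG0
    linarith
  have hs : Real.exp (-(v / 2)) ≤ Real.exp (-(K : ℝ)) := Real.exp_le_exp.2 (by linarith)
  set s := Real.exp (-(v / 2)) with hsdef
  have hs0 : 0 < s := Real.exp_pos _
  have hss : s * s = δ := by rw [hsdef, ← Real.exp_add, ← hvδ]; congr 1; ring
  have h1 : s * (N / 16) ≤ 9 * (s * s) * N := by
    rw [hss]
    exact (mul_le_mul_of_nonneg_right hs (by positivity)).trans hfin
  have h2 : 1 / 16 ≤ 9 * s := by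
    refine le_of_mul_le_mul_left ?_ (mul_pos hs0 hN0)
    linarith
  have h3 : (1 / 144) * (1 / 144) ≤ s * s :=
    mul_le_mul (by linarith) (by linarith) (by norm_num) hs0.le
  rw [hss] at h3
  norm_num at h3 hδ
  linarith

end Parameters

/-! ### The lower bound -/

theorem lemma3p1 :
    ∃ c : ℝ, 0 < c ∧ ∃ U₀ : ℕ, ∀ U : ℕ, U₀ ≤ U → ∀ δ : ℝ,
      Real.exp (-(U : ℝ) ^ (1 / 4 : ℝ)) < δ → δ < 1 / Real.log (U : ℝ) ^ 4 →
      ∃ D : PMF (URDecInput U), ∀ P : OneWayProtocol U,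
        ENNReal.ofReal (1 - δ) ≤ P.successProb D →
        ENNReal.ofReal (c * (Real.log (1 / δ) * Real.log (U : ℝ) ^ 2)) ≤ P.expectedCost D := by
  -- With `C = c v u ^ 2`, the contradiction needs `72 C + 27 ≤ v u ^ 2 / 18432`; the `27` is
  -- absorbed since `v u ^ 2 ≥ 10 ^ 7`.
  refine ⟨1 / 3000000, by norm_num, ⌈Real.exp 1000⌉₊, fun U hU δ hδl hδu => ?_⟩
  have hUe : Real.exp 1000 ≤ U := (Nat.le_ceil _).trans (by exact_mod_cast hU)
  have hU0 : (0 : ℝ) < U := (Real.exp_pos _).trans_le hUe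
  have hu : 1000 ≤ Real.log U := (Real.le_log_iff_exp_le hU0).2 hUe
  have hδ0 : 0 < δ := (Real.exp_pos _).trans hδl
  have hδ12 : δ < 1 / 10 ^ 12 := by
    refine hδu.trans_le (one_div_le_one_div_of_le (by norm_num) ?_)
    calc (10 : ℝ) ^ 12 = 1000 ^ 4 := by norm_num
      _ ≤ Real.log U ^ 4 := pow_le_pow_left₀ (by norm_num) hu 4
  have hδ1 : δ < 1 := by linarith [show (1 : ℝ) / 10 ^ 12 < 1 by norm_num]
  have hv10 := ten_le_log_one_div hδ0 hδ12
  set v := Real.log (1 / δ) with hv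
  have hvδ : Real.exp (-v) = δ := by
    rw [hv, one_div, Real.log_inv, neg_neg, Real.exp_log hδ0]
  have hvU : v ≤ Real.exp (Real.log U / 4) := by
    have h1 : (U : ℝ) ^ (1 / 4 : ℝ) = Real.exp (Real.log U / 4) := by
      rw [Real.rpow_def_of_pos hU0]; congr 1; ring
    rw [h1, ← hvδ, Real.exp_lt_exp] at hδl
    linarith
  obtain ⟨m, K, N, hm, hmU, hK2, hKv, hNge, hvm⟩ := exists_scales hu hv10 hvU
  set u := Real.log (U : ℝ) with hudef
  have hm0 : (0 : ℝ) < m := lt_of_lt_of_le (by positivity) hm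
  have hmpos : 0 < m := by exact_mod_cast hm0
  have hN0 : (0 : ℝ) < N := lt_of_lt_of_le (by positivity) hNge
  have hNpos : 0 < N := by exact_mod_cast hN0
  have hK2' : (2 : ℝ) ≤ K := by exact_mod_cast hK2
  have hρ : 1 / (K : ℝ) ≤ 1 := by rw [div_le_one (by linarith)]; linarith
  have hρ' : 0 ≤ 1 / (K : ℝ) := by positivity
  have : Nonempty (Fin m) := ⟨⟨0, hmpos⟩⟩
  have hBpos : 0 < (32 * m) ^ 2 := by positivity
  have : Nonempty (Fin ((32 * m) ^ 2)) := ⟨⟨0, hBpos⟩⟩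
  obtain ⟨e⟩ : Nonempty (Fin m × Fin ((32 * m) ^ 2) ↪ Fin U) :=
    Function.Embedding.nonempty_of_card_le (by
      rw [Fintype.card_prod, Fintype.card_fin, Fintype.card_fin, Fintype.card_fin]; exact hmU)
  obtain ⟨D, hD⟩ := exists_hard_distribution e (ρ := 1 - 1 / K) (by linarith) (by linarith) hNpos
  refine ⟨D, fun P hsucc => ?_⟩
  by_contra hcost
  push Not at hcost
  have hC0 : 0 < 1 / 3000000 * (v * u ^ 2) := by positivity
  obtain ⟨b, G, hb, hcard, hupper⟩ := hD P δ _ hδ0 hδ1 hC0 hsucc hcost.le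
  have hlog : u / 3 ≤ Real.log (32 * m) := by
    rw [Real.le_log_iff_exp_le (by positivity)]
    linarith [Real.exp_pos (u / 3)]
  have hfin := large_of_sum_guessError_le hb hmpos (by linarith) hK2 hKv hNpos hvδ hδ12 hvm
    hC0.le hcard hupper
  have h1 : (N : ℝ) / 16 * (u / 3) ≤ N / 16 * Real.log (32 * m) :=
    mul_le_mul_of_nonneg_left hlog (by positivity)
  have h2 : v * u / 384 / 16 * (u / 3) ≤ (N : ℝ) / 16 * (u / 3) := by gcongr
  have h3 : (10 : ℝ) * 1000 ^ 2 ≤ v * u ^ 2 := by gcongr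
  linarith
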